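/- All matrices have complex entries. A \emph{matrix convex set} in $g$ variables is a graded set $K=\bigcup_{n\ge 1}K_n$, where $K_n$ is a set of $g$-tuples of $n\times n$ matrices, that is closed under matrix convex combinations $\sum_{j} V_j^*X^{(j)}V_j$ with $X^{(j)}\in K_{n_j}$, $V_j$ of size $n_j\times n$, and $\sum_j V_j^*V_j=I_n$. For a tuple $A=(A_1,\dots,A_g)$ of self-adjoint matrices, the free spectrahedron is $\mathcal D_A=\bigcup_{n\ge 1}\{X\in M_n(\mathbb C)_{\rm sa}^g : I-\sum_i A_i\otimes X_i\succeq 0\}$, and the matrix range $\mathcal W(A)$ consists, at level $n$, of the tuples $(\phi(A_1),\dots,\phi(A_g))$ for unital completely positive maps $\phi$ from the full matrix algebra containing the $A_i$ to $M_n(\mathbb C)$. The free polar dual of $K$ is $K^\circ=\{X \text{ self-adjoint}: \sum_i Y_i\otimes X_i\preceq I \text{ for all } Y\in K\}$. A point $X\in K_n$ is a \emph{free extreme point} of $K$ if, whenever $X=\sum_j V_j^*X^{(j)}V_j$ is a matrix convex combination of points $X^{(j)}\in K$ with every $V_j\neq 0$, each $X^{(j)}$ is unitarily equivalent to $X$ or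 to a direct sum $X\oplus Z$. The minimal (maximal) matrix convex set over a set $C\subseteq\mathbb R^g$ is the smallest (largest) matrix convex set whose first level is $C$. Let $\sigma=\begin{bmatrix}1&0\\0&-1\end{bmatrix}$, $\tau=\begin{bmatrix}0&1\\1&0\end{bmatrix}$, and let $F^{[3]}=(\sigma\otimes\sigma,\ \tau\otimes\sigma,\ I\otimes\tau)$ be the universal triple of pairwise anticommuting self-adjoint unitaries. \textbf{Theorem.} Let $n=4$ or $n=6$. Then $\mathcal D_{F^{[3]}}$ has a free extreme point at level $n$. More precisely, there is a triple $C=(C_1,C_2,C_3)$ of symmetric matrices in $M_{n/2}(\mathbb C)$ such that $$X=\left(\begin{bmatrix}0&C_1\\ \overline{C_1}&0\end{bmatrix},\begin{bmatrix}0&C_2\\ \overline{C_2}&0\end{bmatrix},\begin{bmatrix}0&C_3\\ \overline{C_3}&0\end{bmatrix}\right)$$ is a free extreme point of $\mathcal D_{F^{[3]}}$ at level $n$. Consequently $\mathcal D_{F^{[3]}}$, which is a matrix convex set whose first level is the closed unit ball of $\mathbb R^3$, is not the minimal matrix convex set over that ball, and its free polar dual $\mathcal D_{F^{[3]}}^\circ=\mathcal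 W(F^{[3]})$, which is also a matrix convex set over that ball, is not the maximal one. -/

import Mathlib

open scoped Kronecker Matrix ComplexOrder MatrixOrder Matrix.Norms.L2Operator CStarAlgebra

noncomputable section

/-- `g`-tuples of complex matrices with index type `ι` (level `n` is `ι = Fin n`). -/
abbrev MatTuple (g : ℕ) (ι : Type) : Type := Fin g → Matrix ι ι ℂ

/-- A graded set `K = ⋃ₙ Kₙ` of `g`-tuples of complex `n × n` matrices, ordered by levelwise
inclusion. Only the levels `n ≥ 1` are meaningful: all the sets below are empty at level `0`. -/
abbrev MatrixSet (g : ℕ) : Type := ∀ n : ℕ, Set (MatTuple g (Fin n))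

/-- `K` is matrix convex: it is closed under matrix convex combinations `∑ⱼ Vⱼ* Y⁽ʲ⁾ Vⱼ`,
where `Y⁽ʲ⁾ ∈ K` has size `dⱼ`, `Vⱼ` is `dⱼ × n`, and `∑ⱼ Vⱼ* Vⱼ = Iₙ`. -/
structure IsMatrixConvex {g : ℕ} (K : MatrixSet g) : Prop where
  level_zero : K 0 = ∅
  combination_mem : ∀ (n : ℕ), 0 < n → ∀ (m : ℕ) (d : Fin m → ℕ)
    (Y : ∀ j, MatTuple g (Fin (d j))) (V : ∀ j, Matrix (Fin (d j)) (Fin n) ℂ),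
    (∀ j, Y j ∈ K (d j)) → ∑ j, (V j)ᴴ * V j = 1 →
      (fun i => ∑ j, (V j)ᴴ * Y j i * V j) ∈ K n

/-- The tuples of `1 × 1` matrices whose entries form a point of `C ⊆ ℝᵍ`. -/
def scalarLevel {g : ℕ} (C : Set (EuclideanSpace ℝ (Fin g))) : Set (MatTuple g (Fin 1)) :=
  {x | ∃ v ∈ C, ∀ i, x i = Matrix.of fun _ _ => ((v i : ℝ) : ℂ)}

/-- The matrix convex sets over `C ⊆ ℝᵍ`, that is, those with first level `C`. -/
def matrixConvexSetsOver {g : ℕ} (C : Set (EuclideanSpace ℝ (Fin g))) : Set (MatrixSet g) :=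
  {K | IsMatrixConvex K ∧ K 1 = scalarLevel C}

/-- `K` is the minimal matrix convex set over `C`. -/
def IsMinimalOver {g : ℕ} (C : Set (EuclideanSpace ℝ (Fin g))) (K : MatrixSet g) : Prop :=
  IsLeast (matrixConvexSetsOver C) K

/-- `K` is the maximal matrix convex set over `C`. -/
def IsMaximalOver {g : ℕ} (C : Set (EuclideanSpace ℝ (Fin g))) (K : MatrixSet g) : Prop :=
  IsGreatest (matrixConvexSetsOver C) K

/-- The monic linear pencil `L_A(X) = I - ∑ᵢ Aᵢ ⊗ Xᵢ`. -/
def monicPencil {g : ℕ} {ι κ : Type} [DecidableEq ι] [DecidableEq κ]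
    (A : MatTuple g ι) (X : MatTuple g κ) : Matrix (ι × κ) (ι × κ) ℂ :=
  1 - ∑ i, A i ⊗ₖ X i

/-- The (complex) free spectrahedron `D_A`. -/
def freeSpectrahedron {g : ℕ} {ι : Type} [Fintype ι] [DecidableEq ι] (A : MatTuple g ι) :
    MatrixSet g :=
  fun n => {X | 0 < n ∧ (∀ i, (X i).IsHermitian) ∧ (monicPencil A X).PosSemidef}

/-- The matrix range `W(A)`: the images `φ(A)` under unital completely positive maps `φ` from the
full matrix algebra on which `A` acts to `Mₙ(ℂ)`, `n ≥ 1`. -/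
def matrixRange {g : ℕ} {ι : Type} [Fintype ι] [DecidableEq ι] (A : MatTuple g ι) :
    MatrixSet g :=
  fun n => {X | 0 < n ∧ ∃ φ : Matrix ι ι ℂ →CP Matrix (Fin n) (Fin n) ℂ,
    φ 1 = 1 ∧ ∀ i, φ (A i) = X i}

/-- The (self-adjoint) free polar dual `K°`. -/
def freePolarDual {g : ℕ} (K : MatrixSet g) : MatrixSet g :=
  fun n => {X | 0 < n ∧ (∀ i, (X i).IsHermitian) ∧
    ∀ (m : ℕ), ∀ Y ∈ K m, (monicPencil Y X).PosSemidef}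

/-- Unitary equivalence of matrix tuples; the index types may differ, but the existence of a
(two-sided) unitary between them forces the same size. -/
def UnitarilyEquivalent {g : ℕ} {ι κ : Type} [Fintype ι] [DecidableEq ι] [Fintype κ]
    [DecidableEq κ] (X : MatTuple g ι) (Y : MatTuple g κ) : Prop :=
  ∃ U : Matrix ι κ ℂ, Uᴴ * U = 1 ∧ U * Uᴴ = 1 ∧ ∀ i, Uᴴ * X i * U = Y i

/-- The direct sum of two matrix tuples. -/
def tupleSum {g : ℕ} {ι κ : Type} (X : MatTuple g ι) (Z : MatTuple g κ) : MatTuple g (ι ⊕ κ) :=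
  fun i => Matrix.fromBlocks (X i) 0 0 (Z i)

/-- The free extreme points of `K` at level `n`: points `X` such that, whenever
`X = ∑ⱼ Vⱼ* Y⁽ʲ⁾ Vⱼ` is a matrix convex combination of points `Y⁽ʲ⁾` of `K` with all `Vⱼ ≠ 0`,
each `Y⁽ʲ⁾` is unitarily equivalent to `X` or to `X ⊕ Z` for some `Z` of size at least `1`. -/
def freeExtremePoints {g : ℕ} (K : MatrixSet g) : MatrixSet g :=
  fun n => {X | X ∈ K n ∧ ∀ (m : ℕ) (d : Fin m → ℕ)
    (Y : ∀ j, MatTuple g (Fin (d j))) (V : ∀ j, Matrix (Fin (d j)) (Fin n) ℂ),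
    (∀ j, Y j ∈ K (d j)) → (∀ j, V j ≠ 0) → ∑ j, (V j)ᴴ * V j = 1 →
    (∀ i, X i = ∑ j, (V j)ᴴ * Y j i * V j) →
      ∀ j, UnitarilyEquivalent (Y j) X ∨
        ∃ k : ℕ, 0 < k ∧ ∃ Z : MatTuple g (Fin k), UnitarilyEquivalent (Y j) (tupleSum X Z)}

/-- The universal pair `F^[2]` of anticommuting self-adjoint unitaries. -/
def spinPair : MatTuple 2 (Fin 2) := ![!![1, 0; 0, -1], !![0, 1; 1, 0]]

/-- The step `(F₁, …, F_g) ↦ (F₁ ⊗ σ, …, F_g ⊗ σ, I ⊗ τ)`, with `(σ, τ) = F^[2]`, from the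
universal `g`-tuple of anticommuting self-adjoint unitaries to the universal `(g+1)`-tuple. -/
def spinStep {g : ℕ} {ι : Type} [DecidableEq ι] (F : MatTuple g ι) :
    MatTuple (g + 1) (ι × Fin 2) :=
  Fin.snoc (α := fun _ => Matrix (ι × Fin 2) (ι × Fin 2) ℂ)
    (fun i => F i ⊗ₖ !![1, 0; 0, -1]) ((1 : Matrix ι ι ℂ) ⊗ₖ !![0, 1; 1, 0])

/-- The universal triple `F^[3]` of anticommuting self-adjoint unitaries. -/
def spinTriple : MatTuple 3 (Fin 2 × Fin 2) := spinStep spinPair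

/-- The tuple of block matrices `[[0, Cᵢ], [C̄ᵢ, 0]]`, with entrywise conjugation. -/
def offDiagonalTuple {g k : ℕ} (C : MatTuple g (Fin k)) : MatTuple g (Fin (k + k)) :=
  fun i => Matrix.reindex finSumFinEquiv finSumFinEquiv
    (Matrix.fromBlocks 0 (C i) ((C i).map star) 0)

end

/-! Free extremality of `X` in `D_A` follows from two linear conditions. Let `X = ∑ⱼ Vⱼ* Y⁽ʲ⁾ Vⱼ`
and `v ∈ ker L_A(X)`. The nonnegative numbers `⟨L_A(Y⁽ʲ⁾)(I ⊗ Vⱼ)v, (I ⊗ Vⱼ)v⟩` add up to `⟨L_A(X)v,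
v⟩ = 0`, so `(I ⊗ Vⱼ)v ∈ ker L_A(Y⁽ʲ⁾)`, and hence `∑ᵢ Aᵢ ⊗ (Yᵢ⁽ʲ⁾Vⱼ - VⱼXᵢ)` kills `v`. If the
kernel is large enough (`KernelNondegenerate`), this forces `Yᵢ⁽ʲ⁾Vⱼ = VⱼXᵢ`
(`intertwines_of_combination`). Then `Vⱼ*Vⱼ` commutes with `X`; if `X` is irreducible
(`TrivialCommutant`), it is a positive scalar, `Vⱼ` is a multiple of an isometry, and `X` is a
direct summand of `Y⁽ʲ⁾` (`mem_freeExtremePoints_freeSpectrahedron`).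

Two explicit triples are checked against these conditions. After clearing denominators everything is
an identity over the Gaussian integers: a sum-of-squares certificate for positivity of the pencil,
kernel vectors with a left inverse of the linear system they define, and polynomials in `X` that pin
down the commutant.

For minimality, `minimalSet C` consists of the tuples `∑ⱼ yⱼ ⊗ Pⱼ` with `yⱼ ∈ C`, `Pⱼ ≥ 0` and `∑ⱼ
Pⱼ = I`. Writing `Pⱼ = Sⱼ*Sⱼ` shows such a tuple to be a matrix convex combination of scalar tuples,
so a free extreme point of this kind is scalar. The point at level 4 is not scalar, so it separates
`D_{F^[3]}` from the minimal set.

For the dual side, one Hahn–Banach argument (`exists_separating_pencil`) gives two duality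
statements: `D_A° ⊆ W(A)` for traceless self-adjoint `A`, and the bipolar theorem for the minimal
set. If `W(F^[3]) = D_{F^[3]}°` were maximal, it would contain the polar dual of the minimal set
over the ball; by the bipolar theorem `D_{F^[3]}` would then lie in the minimal set, which the level
4 point excludes. -/

noncomputable section

/-! ### Pencils and matrix convex combinations. -/

section Pencil

variable {g : ℕ} {ι κ : Type} [Fintype ι] [DecidableEq ι] [Fintype κ] [DecidableEq κ]

theorem kronecker_compression {ι κ δ : Type} [Fintype ι] [DecidableEq ι] [Fintype δ]
    (A : Matrix ι ι ℂ) (Y : Matrix δ δ ℂ) (V : Matrix δ κ ℂ) :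
    A ⊗ₖ (Vᴴ * Y * V) = ((1 : Matrix ι ι ℂ) ⊗ₖ V)ᴴ * (A ⊗ₖ Y) * ((1 : Matrix ι ι ℂ) ⊗ₖ V) := by
  rw [Matrix.conjTranspose_kronecker, ← Matrix.mul_kronecker_mul, ← Matrix.mul_kronecker_mul]
  simp

/-- The pencil of a matrix convex combination is a sum of compressions of pencils. -/
theorem monicPencil_combination {ι κ : Type} [Fintype ι] [DecidableEq ι] [DecidableEq κ]
    {J : Type} [Fintype J] {δ : J → Type} [∀ j, Fintype (δ j)]
    [∀ j, DecidableEq (δ j)] (A : MatTuple g ι) (Y : ∀ j, MatTuple g (δ j))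
    (V : ∀ j, Matrix (δ j) κ ℂ) (hV : ∑ j, (V j)ᴴ * V j = 1) :
    monicPencil A (fun i => ∑ j, (V j)ᴴ * Y j i * V j) =
      ∑ j, ((1 : Matrix ι ι ℂ) ⊗ₖ V j)ᴴ * monicPencil A (Y j) * ((1 : Matrix ι ι ℂ) ⊗ₖ V j) := by
  have h1 : (1 : Matrix (ι × κ) (ι × κ) ℂ) =
      ∑ j, ((1 : Matrix ι ι ℂ) ⊗ₖ V j)ᴴ * ((1 : Matrix ι ι ℂ) ⊗ₖ V j) := by
    rw [← Matrix.one_kronecker_one, ← hV]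
    simp only [Matrix.conjTranspose_kronecker, ← Matrix.mul_kronecker_mul,
      Matrix.conjTranspose_one, mul_one]
    exact map_sum (Matrix.kroneckerBilinear (R := ℂ) (1 : Matrix ι ι ℂ)) _ _
  have h2 : ∀ i, A i ⊗ₖ (∑ j, (V j)ᴴ * Y j i * V j) =
      ∑ j, ((1 : Matrix ι ι ℂ) ⊗ₖ V j)ᴴ * (A i ⊗ₖ Y j i) * ((1 : Matrix ι ι ℂ) ⊗ₖ V j) := by
    intro i
    simp only [← kronecker_compression]
    exact map_sum (Matrix.kroneckerBilinear (R := ℂ) (A i)) _ _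
  simp only [monicPencil, h2]
  rw [h1, Finset.sum_comm, ← Finset.sum_sub_distrib]
  refine Finset.sum_congr rfl fun j _ => ?_
  rw [Matrix.mul_sub, Matrix.sub_mul, Matrix.mul_one, Matrix.mul_sum, Matrix.sum_mul]

theorem posSemidef_monicPencil_combination {J : Type} [Fintype J] {δ : J → Type}
    [∀ j, Fintype (δ j)] [∀ j, DecidableEq (δ j)] (A : MatTuple g ι) (Y : ∀ j, MatTuple g (δ j))
    (V : ∀ j, Matrix (δ j) κ ℂ) (hV : ∑ j, (V j)ᴴ * V j = 1)
    (hY : ∀ j, (monicPencil A (Y j)).PosSemidef) :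
    (monicPencil A (fun i => ∑ j, (V j)ᴴ * Y j i * V j)).PosSemidef := by
  rw [monicPencil_combination A Y V hV]
  exact Matrix.posSemidef_sum _ fun j _ => (hY j).conjTranspose_mul_mul_same _

theorem isHermitian_combination {κ J : Type} [Fintype J] {δ : J → Type} [∀ j, Fintype (δ j)]
    (Y : ∀ j, Matrix (δ j) (δ j) ℂ) (V : ∀ j, Matrix (δ j) κ ℂ)
    (hY : ∀ j, (Y j).IsHermitian) : (∑ j, (V j)ᴴ * Y j * V j).IsHermitian := by
  rw [Matrix.IsHermitian, Matrix.conjTranspose_sum]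
  refine Finset.sum_congr rfl fun j _ => ?_
  simp [Matrix.conjTranspose_mul, (hY j).eq, Matrix.mul_assoc]

theorem isMatrixConvex_freeSpectrahedron (A : MatTuple g ι) :
    IsMatrixConvex (freeSpectrahedron A) where
  level_zero := by ext X; simp [freeSpectrahedron]
  combination_mem n hn m d Y V hY hV :=
    ⟨hn, fun i => isHermitian_combination (fun j => Y j i) V fun j => (hY j).2.1 i,
      posSemidef_monicPencil_combination A Y V hV fun j => (hY j).2.2⟩

theorem isMatrixConvex_freePolarDual (K : MatrixSet g) : IsMatrixConvex (freePolarDual K) where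
  level_zero := by ext X; simp [freePolarDual]
  combination_mem n hn m d Y V hY hV :=
    ⟨hn, fun i => isHermitian_combination (fun j => Y j i) V fun j => (hY j).2.1 i,
      fun k Z hZ => posSemidef_monicPencil_combination Z Y V hV fun j => (hY j).2.2 k Z hZ⟩

theorem posSemidef_monicPencil_comm {ι κ : Type} [DecidableEq ι] [DecidableEq κ]
    {A : MatTuple g ι} {X : MatTuple g κ} :
    (monicPencil A X).PosSemidef ↔ (monicPencil X A).PosSemidef := by
  have h : monicPencil A X = (monicPencil X A).submatrix (Equiv.prodComm ι κ)
      (Equiv.prodComm ι κ) := by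
    ext ⟨a, k⟩ ⟨b, l⟩
    simp [monicPencil, Matrix.sum_apply, Matrix.one_apply, and_comm, mul_comm]
  rw [h, Matrix.posSemidef_submatrix_equiv]

theorem kronecker_mulVec_apply {p q r s : Type} [Fintype q] [Fintype s] (A : Matrix p q ℂ)
    (B : Matrix r s ℂ) (v : q × s → ℂ) (x : p × r) :
    ((A ⊗ₖ B) *ᵥ v) x = ∑ b, ∑ t, A x.1 b * B x.2 t * v (b, t) := by
  simp [Matrix.mulVec, dotProduct, Fintype.sum_prod_type]

end Pencil

/-! ### A sufficient criterion for free extreme points. -/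

section FreeExtreme

variable {g : ℕ} {ι κ : Type} [Fintype ι] [DecidableEq ι] [Fintype κ] [DecidableEq κ]

/-- The kernel of the pencil `L_A(X)` does not allow a nonzero one-row dilation of `X`. -/
def KernelNondegenerate (A : MatTuple g ι) (X : MatTuple g κ) : Prop :=
  ∀ r : Fin g → κ → ℂ,
    (∀ v : ι × κ → ℂ, monicPencil A X *ᵥ v = 0 →
      ∀ a, ∑ i, ∑ b, ∑ q, A i a b * r i q * v (b, q) = 0) → r = 0

/-- Only the scalars commute with all matrices of the tuple. -/
def TrivialCommutant (X : MatTuple g κ) : Prop :=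
  ∀ W : Matrix κ κ ℂ, (∀ i, W * X i = X i * W) → ∃ c : ℂ, W = c • 1

theorem monicPencil_mulVec (A : MatTuple g ι) (X : MatTuple g κ) (v : ι × κ → ℂ) :
    monicPencil A X *ᵥ v = v - ∑ i, (A i ⊗ₖ X i) *ᵥ v := by
  rw [monicPencil, Matrix.sub_mulVec, Matrix.one_mulVec, Matrix.sum_mulVec]

/-- A sum of nonnegative terms vanishes only termwise, so each `I ⊗ Vⱼ` carries `ker L_A(X)` into
`ker L_A(Y⁽ʲ⁾)`. Comparing the two kernel equations shows that every row of `Yᵢ⁽ʲ⁾Vⱼ - VⱼXᵢ` is a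
row excluded by nondegeneracy. -/
theorem intertwines_of_combination {J : Type} [Fintype J] {δ : J → Type} [∀ j, Fintype (δ j)]
    [∀ j, DecidableEq (δ j)] {A : MatTuple g ι} {X : MatTuple g κ} (hX : KernelNondegenerate A X)
    {Y : ∀ j, MatTuple g (δ j)} {V : ∀ j, Matrix (δ j) κ ℂ}
    (hY : ∀ j, (monicPencil A (Y j)).PosSemidef) (hV : ∑ j, (V j)ᴴ * V j = 1)
    (hXY : ∀ i, X i = ∑ j, (V j)ᴴ * Y j i * V j) (j : J) (i : Fin g) :
    Y j i * V j = V j * X i := by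
  have hker : ∀ v, monicPencil A X *ᵥ v = 0 →
      monicPencil A (Y j) *ᵥ (((1 : Matrix ι ι ℂ) ⊗ₖ V j) *ᵥ v) = 0 := by
    intro v hv
    have h0 : star v ⬝ᵥ (monicPencil A X *ᵥ v) = 0 := by rw [hv, dotProduct_zero]
    have hX' : X = fun i => ∑ j, (V j)ᴴ * Y j i * V j := funext hXY
    rw [hX', monicPencil_combination A Y V hV, Matrix.sum_mulVec, dotProduct_sum] at h0
    have hnn : ∀ l, star v ⬝ᵥ ((((1 : Matrix ι ι ℂ) ⊗ₖ V l)ᴴ * monicPencil A (Y l) *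
        ((1 : Matrix ι ι ℂ) ⊗ₖ V l)) *ᵥ v) =
        star (((1 : Matrix ι ι ℂ) ⊗ₖ V l) *ᵥ v) ⬝ᵥ
          (monicPencil A (Y l) *ᵥ (((1 : Matrix ι ι ℂ) ⊗ₖ V l) *ᵥ v)) := by
      intro l
      rw [Matrix.star_mulVec, ← Matrix.dotProduct_mulVec]
      simp [Matrix.mulVec_mulVec, Matrix.mul_assoc]
    simp only [hnn] at h0
    have := (Finset.sum_eq_zero_iff_of_nonneg
      (fun l _ => (hY l).dotProduct_mulVec_nonneg _)).1 h0 j (Finset.mem_univ j)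
    exact ((hY j).dotProduct_mulVec_zero_iff _).1 this
  have hr : ∀ p, (fun i q => (Y j i * V j - V j * X i) p q) = (0 : Fin g → κ → ℂ) := by
    intro p
    refine hX _ fun v hv a => ?_
    have e1 := hker v hv
    have e2 : ((1 : Matrix ι ι ℂ) ⊗ₖ V j) *ᵥ (monicPencil A X *ᵥ v) = 0 := by
      rw [hv, Matrix.mulVec_zero]
    rw [monicPencil_mulVec] at e1 e2
    rw [Matrix.mulVec_sub, Matrix.mulVec_sum] at e2
    have e3 : ∑ i, (A i ⊗ₖ (Y j i * V j - V j * X i)) *ᵥ v = 0 := by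
      have : ∀ i, (A i ⊗ₖ (Y j i * V j - V j * X i)) *ᵥ v =
          (A i ⊗ₖ Y j i) *ᵥ (((1 : Matrix ι ι ℂ) ⊗ₖ V j) *ᵥ v) -
            ((1 : Matrix ι ι ℂ) ⊗ₖ V j) *ᵥ ((A i ⊗ₖ X i) *ᵥ v) := by
        intro i
        rw [Matrix.mulVec_mulVec, Matrix.mulVec_mulVec, ← Matrix.mul_kronecker_mul,
          ← Matrix.mul_kronecker_mul, Matrix.mul_one, Matrix.one_mul, ← Matrix.sub_mulVec]
        congr 1
        exact map_sub (Matrix.kroneckerBilinear (R := ℂ) (A i)) _ _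
      simp only [this, Finset.sum_sub_distrib]
      rw [← sub_eq_zero.1 e1, ← sub_eq_zero.1 e2, sub_self]
    have := congrFun e3 (a, p)
    simpa only [Finset.sum_apply, kronecker_mulVec_apply, Pi.zero_apply] using this
  ext p q
  exact sub_eq_zero.1 (congrFun (congrFun (hr p) i) q)

/-- A tuple which has `X` as the compression to a reducing subspace is unitarily equivalent to `X`
or to a direct sum `X ⊕ Z`. -/
theorem unitarilyEquivalent_of_isometry {n d : ℕ} {X : MatTuple g (Fin n)}
    {Y : MatTuple g (Fin d)} (hY : ∀ i, (Y i).IsHermitian)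
    (W : Matrix (Fin d) (Fin n) ℂ) (hW : Wᴴ * W = 1) (hWY : ∀ i, Y i * W = W * X i) :
    UnitarilyEquivalent Y X ∨
      ∃ k : ℕ, 0 < k ∧ ∃ Z : MatTuple g (Fin k), UnitarilyEquivalent Y (tupleSum X Z) := by
  have hcomp : ∀ i, Wᴴ * Y i * W = X i := fun i => by
    rw [Matrix.mul_assoc, hWY, ← Matrix.mul_assoc, hW, Matrix.one_mul]
  have hnd : n ≤ d := by
    have h1 : (Wᴴ * W).rank = n := by rw [hW, Matrix.rank_one, Fintype.card_fin]
    have h2 := Matrix.rank_mul_le_right Wᴴ W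
    have h3 := Matrix.rank_le_height W
    omega
  rcases hnd.eq_or_lt with rfl | hlt
  · exact Or.inl ⟨W, hW, mul_eq_one_comm.1 hW, hcomp⟩
  right
  obtain ⟨k, rfl⟩ := Nat.exists_eq_add_of_lt hlt
  refine ⟨k + 1, k.succ_pos, ?_⟩
  let v : Fin n ⊕ Fin (k + 1) → EuclideanSpace ℂ (Fin (n + k + 1)) :=
    Sum.elim (fun q => WithLp.toLp 2 fun p => W p q) 0
  have hv : Orthonormal ℂ ((Set.range Sum.inl).domRestrict v) := by
    rw [orthonormal_iff_ite]
    rintro ⟨_, q, rfl⟩ ⟨_, r, rfl⟩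
    have := congrFun (congrFun hW q) r
    simp only [Matrix.mul_apply, Matrix.conjTranspose_apply, Matrix.one_apply] at this
    have hin : inner ℂ (v (Sum.inl q)) (v (Sum.inl r)) = if q = r then (1 : ℂ) else 0 := by
      rw [← this, PiLp.inner_apply]
      exact Finset.sum_congr rfl fun p _ => mul_comm _ _
    refine hin.trans (if_congr ⟨fun h => ?_, fun h => ?_⟩ rfl rfl)
    · subst h; rfl
    · exact Sum.inl.inj (congrArg Subtype.val h)
  obtain ⟨b, hb⟩ := hv.exists_orthonormalBasis_extension_of_card_eq
    (by simp [add_assoc])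
  let U : Matrix (Fin (n + k + 1)) (Fin n ⊕ Fin (k + 1)) ℂ := fun p q => b q p
  let Q : Matrix (Fin (n + k + 1)) (Fin (k + 1)) ℂ := fun p q => U p (Sum.inr q)
  have hUW : U = Matrix.fromCols W Q := by
    ext p (q | q)
    · simp [U, hb (Sum.inl q) ⟨q, rfl⟩, v]
    · rfl
  have hU : Uᴴ * U = 1 := by
    ext q r
    have := orthonormal_iff_ite.1 b.orthonormal q r
    rw [PiLp.inner_apply] at this
    rw [Matrix.one_apply, ← this, Matrix.mul_apply]
    exact Finset.sum_congr rfl fun p _ => mul_comm _ _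
  have hU' : U * Uᴴ = 1 := (Matrix.mul_eq_one_comm_of_equiv
    (Fintype.equivOfCardEq (by simp [add_assoc]))).1 hU
  have hQW : Qᴴ * W = 0 := by
    have := hU
    rw [hUW, Matrix.conjTranspose_fromCols_eq_fromRows_conjTranspose, Matrix.fromRows_mul_fromCols,
      ← Matrix.fromBlocks_one, Matrix.fromBlocks_inj] at this
    exact this.2.2.1
  refine ⟨fun i => Qᴴ * Y i * Q, U, hU, hU', fun i => ?_⟩
  -- The range of `W` is invariant under `Y i`; since `Y i` is Hermitian it is reducing, so both
  -- off-diagonal blocks vanish.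
  have h21 : Qᴴ * Y i * W = 0 := by
    rw [Matrix.mul_assoc, hWY, ← Matrix.mul_assoc, hQW, Matrix.zero_mul]
  have h12 : Wᴴ * Y i * Q = 0 := by
    have := congrArg Matrix.conjTranspose h21
    simpa [Matrix.conjTranspose_mul, (hY i).eq, Matrix.mul_assoc] using this
  rw [hUW, Matrix.conjTranspose_fromCols_eq_fromRows_conjTranspose, Matrix.fromRows_mul,
    Matrix.fromRows_mul_fromCols, hcomp, h21, h12]
  rfl

/-- A point of a free spectrahedron whose pencil has a nondegenerate kernel and whose commutant is
trivial is a free extreme point. -/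
theorem mem_freeExtremePoints_freeSpectrahedron {A : MatTuple g ι} {n : ℕ}
    {X : MatTuple g (Fin n)} (hX : X ∈ freeSpectrahedron A n) (hker : KernelNondegenerate A X)
    (hcomm : TrivialCommutant X) : X ∈ freeExtremePoints (freeSpectrahedron A) n := by
  refine ⟨hX, fun m d Y V hY hV hV1 hXY j => ?_⟩
  have hint := intertwines_of_combination hker (fun j => (hY j).2.2) hV1 hXY j
  obtain ⟨c, hc⟩ := hcomm ((V j)ᴴ * V j) fun i => by
    have := congrArg Matrix.conjTranspose (hint i)
    simp only [Matrix.conjTranspose_mul, ((hY j).2.1 i).eq, (hX.2.1 i).eq] at this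
    rw [Matrix.mul_assoc, ← hint, ← Matrix.mul_assoc, this, Matrix.mul_assoc]
  have hn : 0 < n := hX.1
  have hc0 : 0 ≤ c := by
    have := (Matrix.posSemidef_conjTranspose_mul_self (V j)).diag_nonneg (i := ⟨0, hn⟩)
    simpa [hc] using this
  have hc1 : c ≠ 0 := by
    rintro rfl
    rw [zero_smul] at hc
    exact hV j (Matrix.conjTranspose_mul_self_eq_zero.1 hc)
  obtain ⟨t, rfl⟩ : ∃ t : ℝ, (t : ℂ) = c := ⟨c.re, by
    rw [Complex.le_def] at hc0
    apply Complex.ext <;> simp [← hc0.2]⟩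
  have ht : 0 < t := lt_of_le_of_ne (by exact_mod_cast hc0) (by
    rintro rfl; simp at hc1)
  have hs : (((Real.sqrt t)⁻¹ : ℝ) : ℂ) * (((Real.sqrt t)⁻¹ : ℝ) : ℂ) * (t : ℂ) = 1 := by
    rw [← Complex.ofReal_mul, ← Complex.ofReal_mul, ← mul_inv, Real.mul_self_sqrt ht.le,
      inv_mul_cancel₀ ht.ne', Complex.ofReal_one]
  -- As `(V j)ᴴ * V j = t` with `t > 0`, dividing by `√t` makes `V j` an isometry.
  refine unitarilyEquivalent_of_isometry (hY j).2.1
    ((((Real.sqrt t)⁻¹ : ℝ) : ℂ) • V j) ?_ fun i => ?_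
  · rw [Matrix.conjTranspose_smul, Matrix.smul_mul, Matrix.mul_smul, hc, smul_smul, smul_smul,
      Complex.star_def, Complex.conj_ofReal, hs, one_smul]
  · rw [Matrix.mul_smul, Matrix.smul_mul, hint]

end FreeExtreme

/-! ### Certificates over the Gaussian integers. -/

section Certificates

open GaussianInt in
/-- The complex matrix with given Gaussian integer entries. -/
def complexMatrix {m n : Type} (A : Matrix m n GaussianInt) : Matrix m n ℂ := A.map toComplex

variable {l m n p : Type}

theorem complexMatrix_mul [Fintype m] (A : Matrix l m GaussianInt) (B : Matrix m n GaussianInt) :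
    complexMatrix (A * B) = complexMatrix A * complexMatrix B := Matrix.map_mul

theorem complexMatrix_add (A B : Matrix l m GaussianInt) :
    complexMatrix (A + B) = complexMatrix A + complexMatrix B :=
  Matrix.map_add _ (map_add _) _ _

theorem complexMatrix_sub (A B : Matrix l m GaussianInt) :
    complexMatrix (A - B) = complexMatrix A - complexMatrix B :=
  Matrix.map_sub _ (map_sub _) _ _

theorem complexMatrix_zero : complexMatrix (0 : Matrix l m GaussianInt) = 0 :=
  Matrix.map_zero _ (map_zero _)

theorem complexMatrix_natCast [DecidableEq m] (r : ℕ) :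
    complexMatrix (r : Matrix m m GaussianInt) = (r : Matrix m m ℂ) := by
  ext i j
  simp only [complexMatrix, Matrix.map_apply, Matrix.natCast_apply]
  split_ifs <;> simp

theorem complexMatrix_nsmul (r : ℕ) (A : Matrix l m GaussianInt) :
    complexMatrix (r • A) = r • complexMatrix A := by
  ext i j
  simp [complexMatrix]

theorem complexMatrix_conjTranspose (A : Matrix l m GaussianInt) :
    complexMatrix Aᴴ = (complexMatrix A)ᴴ := by
  ext i j
  simp [complexMatrix, GaussianInt.toComplex_star]

theorem complexMatrix_kronecker (A : Matrix l m GaussianInt) (B : Matrix n p GaussianInt) :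
    complexMatrix (A ⊗ₖ B) = complexMatrix A ⊗ₖ complexMatrix B := by
  ext i j
  simp [complexMatrix]

theorem complexMatrix_sum {J : Type} (s : Finset J) (A : J → Matrix l m GaussianInt) :
    complexMatrix (∑ j ∈ s, A j) = ∑ j ∈ s, complexMatrix (A j) := by
  ext i j
  simp [complexMatrix, Matrix.sum_apply]

variable {g : ℕ} {ι κ : Type} [Fintype ι] [DecidableEq ι] [Fintype κ] [DecidableEq κ]

/-- The tuple of the matrices `r⁻¹ Xᵢ`, for Gaussian integer matrices `Xᵢ`. -/
def scaledTuple (r : ℕ) (X : Fin g → Matrix κ κ GaussianInt) : MatTuple g κ :=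
  fun i => (r : ℂ)⁻¹ • complexMatrix (X i)

/-- The pencil `r L_F(r⁻¹ X) = r - ∑ᵢ Fᵢ ⊗ Xᵢ` for Gaussian integer matrices. -/
def integerPencil (r : ℕ) (F : Fin g → Matrix ι ι GaussianInt)
    (X : Fin g → Matrix κ κ GaussianInt) : Matrix (ι × κ) (ι × κ) GaussianInt :=
  r - ∑ i, F i ⊗ₖ X i

theorem monicPencil_scaledTuple {ι κ : Type} [DecidableEq ι] [DecidableEq κ]
    {r : ℕ} (hr : r ≠ 0) (F : Fin g → Matrix ι ι GaussianInt)
    (X : Fin g → Matrix κ κ GaussianInt) :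
    monicPencil (fun i => complexMatrix (F i)) (scaledTuple r X) =
      (r : ℂ)⁻¹ • complexMatrix (integerPencil r F X) := by
  have hr' : (r : ℂ) ≠ 0 := Nat.cast_ne_zero.2 hr
  rw [monicPencil, integerPencil, complexMatrix_sub, complexMatrix_natCast, complexMatrix_sum,
    smul_sub, Finset.smul_sum]
  congr 1
  · ext i j
    simp [Matrix.natCast_apply, Matrix.one_apply, hr']
  · exact Finset.sum_congr rfl fun i _ => by
      rw [complexMatrix_kronecker, scaledTuple, Matrix.kronecker_smul]

/-- If `r L` is a sum of multiples of `L²` and of a Gram matrix, then the pencil is positive. -/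
theorem scaledTuple_mem_freeSpectrahedron {r s t u n : ℕ} (hn : 0 < n) (hr : r ≠ 0) (hs : s ≠ 0)
    {F : Fin g → Matrix ι ι GaussianInt} {X : Fin g → Matrix (Fin n) (Fin n) GaussianInt}
    (hF : ∀ i, (F i)ᴴ = F i) (hX : ∀ i, (X i)ᴴ = X i) {m : Type} [Fintype m]
    (N : Matrix (ι × Fin n) m GaussianInt)
    (hN : s • integerPencil r F X =
      t • (integerPencil r F X * integerPencil r F X) + u • (N * Nᴴ)) :
    scaledTuple r X ∈ freeSpectrahedron (fun i => complexMatrix (F i)) n := by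
  refine ⟨hn, fun i => ?_, ?_⟩
  · rw [Matrix.IsHermitian, scaledTuple, Matrix.conjTranspose_smul, ← complexMatrix_conjTranspose,
      hX]
    simp
  · have hL : (integerPencil r F X)ᴴ = integerPencil r F X := by
      simp [integerPencil, Matrix.conjTranspose_sub, Matrix.conjTranspose_sum,
        Matrix.conjTranspose_kronecker, hF, hX]
    rw [monicPencil_scaledTuple hr]
    set L := integerPencil r F X
    have h1 : complexMatrix L = (s : ℂ)⁻¹ •
        (t • ((complexMatrix L)ᴴ * complexMatrix L) +
          u • (complexMatrix N * (complexMatrix N)ᴴ)) := by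
      rw [← complexMatrix_conjTranspose, ← complexMatrix_conjTranspose, hL, ← complexMatrix_mul,
        ← complexMatrix_mul, ← complexMatrix_nsmul, ← complexMatrix_nsmul, ← complexMatrix_add,
        ← hN, complexMatrix_nsmul, ← Nat.cast_smul_eq_nsmul ℂ, smul_smul,
        inv_mul_cancel₀ (Nat.cast_ne_zero.2 hs), one_smul]
    rw [h1]
    simp only [← Nat.cast_smul_eq_nsmul ℂ]
    exact ((((Matrix.posSemidef_conjTranspose_mul_self _).smul (Nat.cast_nonneg t)).add
      ((Matrix.posSemidef_self_mul_conjTranspose _).smul (Nat.cast_nonneg u))).smul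
        (by positivity)).smul (by positivity)

/-- The kernel of the pencil is nondegenerate if the linear system given by some of its vectors has
a left inverse. -/
theorem kernelNondegenerate_scaledTuple {r : ℕ} {c : GaussianInt} (hr : r ≠ 0) (hc : c ≠ 0)
    {F : Fin g → Matrix ι ι GaussianInt} {X : Fin g → Matrix κ κ GaussianInt}
    {ρ m : Type} [Fintype ρ] [Fintype m] (K : Matrix (ι × κ) m GaussianInt)
    (hK : integerPencil r F X * K = 0) (a : ρ → ι) (j : ρ → m)
    (G : Fin g → κ → ρ → GaussianInt)
    (hG : ∀ i q i' q', ∑ x, G i q x * ∑ b, F i' (a x) b * K (b, q') (j x) =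
      if i = i' ∧ q = q' then c else 0) :
    KernelNondegenerate (fun i => complexMatrix (F i)) (scaledTuple r X) := by
  intro v hv
  have hker : ∀ y, monicPencil (fun i => complexMatrix (F i)) (scaledTuple r X) *ᵥ
      (fun z => complexMatrix K z y) = 0 := by
    intro y
    have : complexMatrix (integerPencil r F X) * complexMatrix K = 0 := by
      rw [← complexMatrix_mul, hK, complexMatrix_zero]
    rw [monicPencil_scaledTuple hr, Matrix.smul_mulVec]
    convert smul_zero _
    ext x
    exact congrFun (congrFun this x) y
  have hrow : ∀ x, ∑ i', ∑ q', (∑ b, (F i' (a x) b * K (b, q') (j x) : GaussianInt) : ℂ) *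
      v i' q' = 0 := by
    intro x
    rw [← hv _ (hker (j x)) (a x)]
    refine Finset.sum_congr rfl fun i' _ => ?_
    rw [Finset.sum_comm]
    refine Finset.sum_congr rfl fun q' _ => ?_
    rw [Finset.sum_mul]
    refine Finset.sum_congr rfl fun b _ => ?_
    simp only [complexMatrix, Matrix.map_apply, map_mul]
    ring
  ext i q
  have h1 : ∑ x, (G i q x : ℂ) * ∑ i', ∑ q',
      (∑ b, (F i' (a x) b * K (b, q') (j x) : GaussianInt) : ℂ) * v i' q' = 0 :=
    Finset.sum_eq_zero fun x _ => by rw [hrow x, mul_zero]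
  have h2 : ∑ x, (G i q x : ℂ) * ∑ i', ∑ q',
      (∑ b, (F i' (a x) b * K (b, q') (j x) : GaussianInt) : ℂ) * v i' q' =
      ∑ i', ∑ q', (if i = i' ∧ q = q' then (c : ℂ) else 0) * v i' q' := by
    have h3 : ∀ i' q', (if i = i' ∧ q = q' then (c : ℂ) else 0) =
        ∑ x, (G i q x : ℂ) * (∑ b, (F i' (a x) b * K (b, q') (j x) : GaussianInt) : ℂ) := by
      intro i' q'
      have := congrArg GaussianInt.toComplex (hG i q i' q')
      rw [apply_ite GaussianInt.toComplex, map_zero, map_sum] at this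
      rw [← this]
      simp only [map_mul, map_sum]
    simp only [h3, Finset.mul_sum (s := Finset.univ), Finset.sum_mul (s := Finset.univ)]
    rw [Finset.sum_comm]
    refine Finset.sum_congr rfl fun i' _ => ?_
    rw [Finset.sum_comm]
    refine Finset.sum_congr rfl fun q' _ => Finset.sum_congr rfl fun x _ => ?_
    refine Finset.sum_congr rfl fun b _ => ?_
    ring
  rw [h2] at h1
  have h4 : (c : ℂ) * v i q = 0 := by
    rw [← h1, Finset.sum_eq_single i, Finset.sum_eq_single q]
    · simp
    · intro q' _ hq'
      simp [hq'.symm]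
    · simp
    · intro i' _ hi'
      simp [hi'.symm]
    · simp
  have hc' : (c : ℂ) ≠ 0 := by
    intro h
    exact hc (GaussianInt.toComplex_eq_zero.1 h)
  simpa [hc'] using h4

end Certificates

/-! ### The explicit triples at levels 4 and 6. -/

section ExtremePoints

/-- The triple `F^[3]` as a triple of Gaussian integer matrices. -/
def integerSpinTriple : Fin 3 → Matrix (Fin 2 × Fin 2) (Fin 2 × Fin 2) GaussianInt :=
  ![!![1, 0; 0, -1] ⊗ₖ !![1, 0; 0, -1], !![0, 1; 1, 0] ⊗ₖ !![1, 0; 0, -1],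
    !![1, 0; 0, 1] ⊗ₖ !![0, 1; 1, 0]]

theorem spinTriple_eq_complexMatrix :
    spinTriple = fun i => complexMatrix (integerSpinTriple i) := by
  ext i ⟨a, b⟩ ⟨c, d⟩
  fin_cases i <;> fin_cases a <;> fin_cases b <;> fin_cases c <;> fin_cases d <;>
    simp [spinTriple, spinStep, spinPair, integerSpinTriple, complexMatrix, Fin.snoc]

/-- A triple of integer matrices, the second one multiplied by `i`. -/
def phaseTuple {m n : Type} (A : Fin 3 → Matrix m n ℤ) (i : Fin 3) : Matrix m n GaussianInt :=
  Matrix.of fun p q => if i = 1 then ⟨0, A i p q⟩ else ⟨A i p q, 0⟩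

/-- The matrix whose blocks are integral, those in the lower half multiplied by `i`. -/
def phaseMatrix {m n : Type} (A : Fin 2 → Fin 2 → Matrix m n ℤ) :
    Matrix ((Fin 2 × Fin 2) × m) n GaussianInt :=
  Matrix.of fun x q => if x.1.1 = 0 then ⟨A x.1.1 x.1.2 x.2 q, 0⟩ else ⟨0, A x.1.1 x.1.2 x.2 q⟩

/-- The integer matrices of the free extreme point at level 4, up to a positive factor and up to a
factor `i` in the second one. -/
def coeffFour : Fin 3 → Matrix (Fin 4) (Fin 4) ℤ :=
  ![
    !![0, 0, 0, 3; 0, 0, 3, 0; 0, 3, 0, 0; 3, 0, 0, 0],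
    !![0, 0, 3, 0; 0, 0, 0, -1; -3, 0, 0, 0; 0, 1, 0, 0],
    !![0, 0, 1, 0; 0, 0, 0, 3; 1, 0, 0, 0; 0, 3, 0, 0]]

/-- The defect of the pencil at level 4 is the Gram matrix of these columns. -/
def defectFour : Fin 2 → Fin 2 → Matrix (Fin 4) (Fin 4) ℤ :=
  ![![
      !![2, 0, 0, 0; 0, 0, -2, 0; 0, 0, 0, 2; 0, -2, 0, 0],
      !![0, 0, -2, 0; -2, 0, 0, 0; 0, -2, 0, 0; 0, 0, 0, -2]], ![
      !![0, 0, 2, 0; -2, 0, 0, 0; 0, -2, 0, 0; 0, 0, 0, 2],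
      !![2, 0, 0, 0; 0, 0, 2, 0; 0, 0, 0, -2; 0, -2, 0, 0]]]

/-- Vectors in the kernel of the pencil at level 4. -/
def kernelFour : Fin 2 → Fin 2 → Matrix (Fin 4) (Fin 6) ℤ :=
  ![![
      !![5, 7, 0, 8, 5, 1; -1, 5, 6, 0, 7, 5; 5, 5, 10, 0, 5, 5; 5, 5, 0, 0, 5, -5],
      !![7, -5, 8, 0, 1, -5; 5, 1, 0, -6, 5, -7; -5, 5, 0, 10, -5, 5; -5, 5, 0, 0, 5, 5]], ![
      !![7, 5, 8, 0, 1, 5; 5, -1, 0, 6, 5, 7; -5, -5, 0, -10, -5, -5; -5, -5, 0, 0, 5, -5],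
      !![5, -7, 0, -8, 5, -1; -1, -5, 6, 0, 7, -5; 5, -5, 10, 0, 5, -5; 5, -5, 0, 0, 5, 5]]]

/-- A left inverse of the linear system given by the kernel vectors at level 4. -/
def inverseFour : Fin 3 → Matrix (Fin 4) (Fin 12) ℤ :=
  ![
    !![0, -6, 6, 0, 0, -8, 8, 0, 0, 6, -6, 0; -8, 0, 0, -8, 6, 0, 0, 6, 8, 0, 0, 8; 0, 0, 0, 0, 10,
      0, 0, -10, 0, 0, 0, 0; 0, 10, 10, 0, 0, 0, 0, 0, 0, -10, -10, 0],
    !![-7, 5, -5, -7, -1, -5, 5, -1, 7, 5, -5, 7; -5, -7, 7, -5, 5, -1, 1, 5, -5, 7, -7, -5; 5, -5,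
      -5, -5, -5, 5, 5, 5, 5, 5, 5, -5; 5, 5, 5, -5, -5, -5, -5, 5, -5, 5, 5, 5],
    !![-1, 5, -5, -1, 7, -5, 5, 7, 1, 5, -5, 1; 5, -1, 1, 5, -5, 7, -7, -5, 5, 1, -1, 5; -5, 5, 5,
      5, 5, 5, 5, -5, -5, -5, -5, 5; -5, 5, 5, 5, -5, -5, -5, 5, 5, 5, 5, -5]]

theorem conjTranspose_coeffFour (i : Fin 3) :
    (phaseTuple coeffFour i)ᴴ = phaseTuple coeffFour i := by
  revert i
  decide +kernel

theorem mem_freeSpectrahedron_four :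
    scaledTuple 5 (phaseTuple coeffFour) ∈ freeSpectrahedron spinTriple 4 := by
  rw [spinTriple_eq_complexMatrix]
  -- With `T = ∑ᵢ Fᵢ ⊗ Xᵢ` and `L = 5 - T`, the choice `s = 2rt` turns the certificate into `25 - T²
  -- = (3/2) N N*`, which bounds `T` by `5` in norm.
  exact scaledTuple_mem_freeSpectrahedron (s := 40) (t := 4) (u := 6) (by decide) (by decide)
    (by decide) (by decide +kernel) conjTranspose_coeffFour (phaseMatrix defectFour)
    (by decide +kernel)

theorem kernelNondegenerate_four :
    KernelNondegenerate spinTriple (scaledTuple 5 (phaseTuple coeffFour)) := by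
  rw [spinTriple_eq_complexMatrix]
  exact kernelNondegenerate_scaledTuple (c := 200) (by decide) (by decide +kernel)
    (phaseMatrix kernelFour) (by decide +kernel)
    -- Two of the four values of `a`, for each of six kernel vectors, already give 12 equations for
    -- the `3 · 4` unknowns; `200` is the common denominator of the inverse.
    (fun x : Fin 12 => ((0, if x.val % 2 = 0 then 0 else 1) : Fin 2 × Fin 2))
    (fun x => (⟨x.val / 2, by omega⟩ : Fin 6))
    (fun i q x => phaseTuple inverseFour i q x) (by decide +kernel)

/-- The integer matrices of the free extreme point at level 6, up to a positive factor and up to a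
factor `i` in the second one. -/
def coeffSix : Fin 3 → Matrix (Fin 6) (Fin 6) ℤ :=
  ![
    !![0, 0, 0, 0, -1, 0; 0, 0, 0, -1, 0, -2; 0, 0, 0, 0, -2, 0; 0, -1, 0, 0, 0, 0; -1, 0, -2, 0, 0,
      0; 0, -2, 0, 0, 0, 0],
    !![0, 0, 0, -1, 0, 2; 0, 0, 0, 0, -1, 0; 0, 0, 0, 2, 0, 0; 1, 0, -2, 0, 0, 0; 0, 1, 0, 0, 0, 0;
      -2, 0, 0, 0, 0, 0],
    !![0, 0, 0, -1, 0, 0; 0, 0, 0, 0, 1, 0; 0, 0, 0, 0, 0, 1; -1, 0, 0, 0, 0, 0; 0, 1, 0, 0, 0, 0;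
      0, 0, 1, 0, 0, 0]]

/-- The defect of the pencil at level 6 is the Gram matrix of these columns. -/
def defectSix : Fin 2 → Fin 2 → Matrix (Fin 6) (Fin 4) ℤ :=
  ![![
      !![2, 0, 0, 0; 0, 0, 2, 0; 0, 0, 0, 0; 0, 0, 0, 2; 0, 2, 0, 0; 0, 0, 0, 0],
      !![0, 0, -2, 0; 2, 0, 0, 0; 0, 0, 0, 0; 0, -2, 0, 0; 0, 0, 0, 2; 0, 0, 0, 0]], ![
      !![0, 0, 2, 0; 2, 0, 0, 0; 0, 0, 0, 0; 0, -2, 0, 0; 0, 0, 0, -2; 0, 0, 0, 0],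
      !![2, 0, 0, 0; 0, 0, -2, 0; 0, 0, 0, 0; 0, 0, 0, -2; 0, 2, 0, 0; 0, 0, 0, 0]]]

/-- Vectors in the kernel of the pencil at level 6. -/
def kernelSix : Fin 2 → Fin 2 → Matrix (Fin 6) (Fin 10) ℤ :=
  ![![
      !![2, 2, 2, -2, 1, -1, 1, 1, 0, -4; -2, -2, 2, -2, 1, -1, -1, -1, -2, 0; -1, 1, -1, -1, 4, 4,
        4, -4, 0, 4; 0, 0, 0, 0, 3, 3, -3, 3, 6, 0; 0, 0, 0, 0, -3, -3, -3, 3, 0, 0; 3, 3, -3, 3, 0,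
        0, 0, 0, 0, 0],
      !![2, -2, -2, -2, -1, -1, 1, -1, -4, 0; -2, 2, -2, -2, -1, -1, -1, 1, 0, 2; 1, 1, -1, 1, 4,
        -4, -4, -4, 4, 0; 0, 0, 0, 0, -3, 3, -3, -3, 0, 6; 0, 0, 0, 0, 3, -3, -3, -3, 0, 0; -3, 3,
        -3, -3, 0, 0, 0, 0, 0, 0]], ![
      !![2, 2, -2, 2, -1, 1, 1, 1, -4, 0; -2, -2, -2, 2, -1, 1, -1, -1, 0, -2; 1, -1, -1, -1, 4, 4,
        -4, 4, 4, 0; 0, 0, 0, 0, -3, -3, -3, 3, 0, -6; 0, 0, 0, 0, 3, 3, -3, 3, 0, 0; -3, -3, -3, 3,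
        0, 0, 0, 0, 0, 0],
      !![2, -2, 2, 2, 1, 1, 1, -1, 0, 4; -2, 2, 2, 2, 1, 1, -1, 1, -2, 0; -1, -1, -1, 1, 4, -4, 4,
        4, 0, -4; 0, 0, 0, 0, 3, -3, -3, -3, 6, 0; 0, 0, 0, 0, -3, 3, -3, -3, 0, 0; 3, -3, -3, -3,
        0, 0, 0, 0, 0, 0]]]

/-- A left inverse of the linear system given by the kernel vectors at level 6. -/
def inverseSix : Fin 3 → Matrix (Fin 6) (Fin 20) ℤ :=
  ![
    !![-4, 0, 4, 0, 0, 4, 0, -4, 4, 2, -2, 4, 4, -2, 2, 4, 0, 6, -6, 0; -4, 0, -4, -8, 0, -4, 0, 4,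
      8, 4, -4, 8, 0, -4, 4, 0, -6, 0, 0, -6; -2, 0, 2, 0, 0, 2, 0, -2, 2, -2, 2, 2, 2, 2, -2, 2, 0,
      0, 0, 0; 0, 0, 0, 0, 0, 0, 0, 0, 0, 0, 0, 0, 0, 0, 0, 0, 6, 0, 0, -6; 0, 0, 0, 0, 0, 0, 0, 0,
      0, -6, -6, 0, 0, 6, 6, 0, 0, 6, 6, 0; 6, 0, 6, 0, 0, 6, 0, 6, -6, -6, 6, -6, -6, 6, -6, -6, 0,
      0, 0, 0],
    !![-4, 8, -4, 0, 0, 4, 0, -4, 1, 5, -5, 1, 7, -3, 3, 7, 6, 0, 0, 6; 4, 0, -4, 0, 0, -4, 0, 4, 5,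
      7, -7, 5, 5, -7, 7, 5, 0, -6, 6, 0; 0, -2, 0, -2, 0, -2, 0, 2, -2, 2, -2, -2, 2, 2, -2, 2, 0,
      0, 0, 0; 0, 0, 0, 0, 0, 0, 0, 0, 3, -3, -3, -3, 3, 3, 3, -3, 0, 6, 6, 0; 0, 0, 0, 0, 0, 0, 0,
      0, -3, -3, -3, 3, 3, -3, -3, -3, 6, 0, 0, -6; 0, 6, 0, -6, 0, -6, 0, -6, 6, 6, -6, 6, 6, -6,
      6, 6, 0, 0, 0, 0],
    !![0, 8, 0, 8, 0, 8, 0, -8, -1, 1, -1, -1, 1, 1, -1, 1, 0, 0, 0, 0; -8, 0, 8, 0, 0, 8, 0, -8,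
      -1, 1, -1, -1, -1, -1, 1, -1, 0, 0, 0, 0; 2, -2, 2, 2, 0, 0, 0, 0, 0, 0, 0, 0, -4, 4, -4, -4,
      0, 0, 0, 0; 0, 0, 0, 0, 0, 0, 0, 0, -3, 3, 3, 3, -3, -3, -3, 3, 0, 0, 0, 0; 0, 0, 0, 0, 0, 0,
      0, 0, 3, -3, -3, -3, -3, -3, -3, 3, 0, 0, 0, 0; -6, 6, 6, 6, 0, 0, 0, 0, 0, 0, 0, 0, 0, 0, 0,
      0, 0, 0, 0, 0]]

theorem conjTranspose_coeffSix (i : Fin 3) :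
    (phaseTuple coeffSix i)ᴴ = phaseTuple coeffSix i := by
  revert i
  decide +kernel

theorem mem_freeSpectrahedron_six :
    scaledTuple 3 (phaseTuple coeffSix) ∈ freeSpectrahedron spinTriple 6 := by
  rw [spinTriple_eq_complexMatrix]
  -- Again `s = 2rt`, now with `r = 3`: the identity is `9 - T² = (1/2) N N*`.
  exact scaledTuple_mem_freeSpectrahedron (s := 24) (t := 4) (u := 2) (by decide) (by decide)
    (by decide) (by decide +kernel) conjTranspose_coeffSix (phaseMatrix defectSix)
    (by decide +kernel)

theorem kernelNondegenerate_six :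
    KernelNondegenerate spinTriple (scaledTuple 3 (phaseTuple coeffSix)) := by
  rw [spinTriple_eq_complexMatrix]
  exact kernelNondegenerate_scaledTuple (c := 72) (by decide) (by decide +kernel)
    (phaseMatrix kernelSix) (by decide +kernel)
    -- Ten kernel vectors and two values of `a` give 20 equations for the `3 · 6` unknowns.
    (fun x : Fin 20 => ((0, if x.val % 2 = 0 then 0 else 1) : Fin 2 × Fin 2))
    (fun x => (⟨x.val / 2, by omega⟩ : Fin 10))
    (fun i q x => phaseTuple inverseSix i q x) (by decide +kernel)

end ExtremePoints

/-! ### Irreducibility of the two triples. -/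

section Commutant

theorem complexMatrix_smul {l m : Type} (c : GaussianInt) (A : Matrix l m GaussianInt) :
    complexMatrix (c • A) = (c : ℂ) • complexMatrix A := by
  ext i j
  simp [complexMatrix]

theorem commute_complexMatrix {g : ℕ} {κ : Type} [Fintype κ] {r : ℕ} (hr : r ≠ 0)
    {X : Fin g → Matrix κ κ GaussianInt} {W : Matrix κ κ ℂ}
    (hW : ∀ i, W * scaledTuple r X i = scaledTuple r X i * W) (i : Fin g) :
    Commute W (complexMatrix (X i)) := by
  have h := hW i
  rw [scaledTuple, Matrix.mul_smul, Matrix.smul_mul] at h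
  exact smul_right_injective _ (inv_ne_zero (Nat.cast_ne_zero.2 hr)) h

theorem apply_eq_zero_of_commute_diagonal {κ : Type} [Fintype κ] [DecidableEq κ]
    {W : Matrix κ κ ℂ} {A : Matrix κ κ GaussianInt}
    (hW : Commute W (complexMatrix A)) (d : κ → GaussianInt) (hA : A = Matrix.diagonal d) {p q : κ}
    (hpq : d p ≠ d q) : W p q = 0 := by
  have hd : complexMatrix A = Matrix.diagonal fun p => (d p : ℂ) := by
    rw [hA, complexMatrix, Matrix.diagonal_map (map_zero _)]
  have h := congrFun (congrFun hW.eq p) q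
  rw [hd, Matrix.mul_diagonal, Matrix.diagonal_mul] at h
  have h1 : W p q * ((d q : ℂ) - d p) = 0 := by linear_combination h
  rcases mul_eq_zero.1 h1 with h2 | h2
  · exact h2
  · exact absurd (GaussianInt.toComplex_injective (sub_eq_zero.1 h2)).symm hpq

theorem apply_self_eq_of_commute {κ : Type} [Fintype κ] {W : Matrix κ κ ℂ}
    {A : Matrix κ κ GaussianInt} (hW : Commute W (complexMatrix A))
    (hd : ∀ p q, p ≠ q → W p q = 0) {p q : κ} (hpq : A p q ≠ 0) : W p p = W q q := by
  have h := congrFun (congrFun hW.eq p) q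
  rw [Matrix.mul_apply, Matrix.mul_apply, Finset.sum_eq_single p, Finset.sum_eq_single q] at h
  · have h2 : complexMatrix A p q ≠ 0 := fun h => hpq (GaussianInt.toComplex_eq_zero.1 h)
    exact mul_right_cancel₀ h2 (h.trans (mul_comm _ _))
  · intro s _ hs
    rw [hd s q hs, mul_zero]
  · simp
  · intro s _ hs
    rw [hd p s hs.symm, zero_mul]
  · simp

theorem eq_smul_one {κ : Type} [DecidableEq κ] {W : Matrix κ κ ℂ}
    (hd : ∀ p q, p ≠ q → W p q = 0) (p₀ : κ) (h : ∀ p, W p p = W p₀ p₀) : W = W p₀ p₀ • 1 := by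
  ext p q
  by_cases hpq : p = q
  · subst hpq
    simp [h]
  · simp [hd p q hpq, hpq]

theorem trivialCommutant_four : TrivialCommutant (scaledTuple 5 (phaseTuple coeffFour)) := by
  intro W hW
  have hX := commute_complexMatrix (by decide) hW
  set X := phaseTuple coeffFour with hXdef
  -- This polynomial equals `diag(1+3i, 9-3i, 1-3i, 9+3i)`. Its entries are distinct, so `W` is
  -- diagonal; nonzero entries of `X 0` and `X 1` then link all diagonal entries of `W`.
  have hQ : Commute W (complexMatrix (X 2 * X 2 + X 1 * X 2)) := by
    rw [complexMatrix_add, complexMatrix_mul, complexMatrix_mul]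
    exact ((hX 2).mul_right (hX 2)).add_right ((hX 1).mul_right (hX 2))
  have hd : ∀ p q, p ≠ q → W p q = 0 := fun p q hpq =>
    apply_eq_zero_of_commute_diagonal hQ (fun p => (X 2 * X 2 + X 1 * X 2) p p)
      (by rw [hXdef]; decide +kernel) (by revert p q; rw [hXdef]; decide +kernel)
  refine ⟨W 0 0, eq_smul_one hd 0 fun p => ?_⟩
  have h03 : W 0 0 = W 3 3 := apply_self_eq_of_commute (hX 0) hd (by rw [hXdef]; decide +kernel)
  have h02 : W 0 0 = W 2 2 := apply_self_eq_of_commute (hX 1) hd (by rw [hXdef]; decide +kernel)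
  have h12 : W 1 1 = W 2 2 := apply_self_eq_of_commute (hX 0) hd (by rw [hXdef]; decide +kernel)
  fin_cases p
  exacts [rfl, h12.trans h02.symm, h02.symm, h03.symm]

theorem trivialCommutant_six : TrivialCommutant (scaledTuple 3 (phaseTuple coeffSix)) := by
  intro W hW
  have hX := commute_complexMatrix (by decide) hW
  set X := phaseTuple coeffSix with hXdef
  -- This polynomial equals `diag(2, 2, 8, 2, 2, 8)`, so `W` preserves the splitting of the indices
  -- into `{0, 1, 3, 4}` and `{2, 5}`.
  have hQ : Commute W (complexMatrix (X 2 * X 0 * (X 2 * X 0) + X 2 * X 1 * (X 2 * X 1))) := by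
    simp only [complexMatrix_add, complexMatrix_mul]
    exact (((hX 2).mul_right (hX 0)).mul_right ((hX 2).mul_right (hX 0))).add_right
      (((hX 2).mul_right (hX 1)).mul_right ((hX 2).mul_right (hX 1)))
  have hQ0 : ∀ p q, (p.val % 3 = 2 ↔ q.val % 3 ≠ 2) → W p q = 0 := fun p q hpq =>
    apply_eq_zero_of_commute_diagonal hQ
      (fun p => (X 2 * X 0 * (X 2 * X 0) + X 2 * X 1 * (X 2 * X 1)) p p)
      (by rw [hXdef]; decide +kernel) (by revert p q; rw [hXdef]; decide +kernel)
  have hB : Commute W (complexMatrix ((⟨0, 1⟩ : GaussianInt) • (X 2 * X 1))) := by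
    rw [complexMatrix_smul, complexMatrix_mul]
    exact ((hX 2).mul_right (hX 1)).smul_right _
  have hBd : (⟨0, 1⟩ : GaussianInt) • (X 2 * X 1) = !![1, 0, -2, 0, 0, 0; 0, -1, 0, 0, 0, 0;
      2, 0, 0, 0, 0, 0; 0, 0, 0, -1, 0, 2; 0, 0, 0, 0, 1, 0; 0, 0, 0, -2, 0, 0] := by
    rw [hXdef]
    decide +kernel
  rw [hBd] at hB
  have hentry : ∀ p q, _ = _ := fun p q => congrFun (congrFun hB.eq p) q
  simp only [Matrix.mul_apply, Fin.sum_univ_six, complexMatrix, Matrix.map_apply] at hentry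
  have hd : ∀ p q, p ≠ q → W p q = 0 := by
    have z02 := hQ0 0 2 (by decide)
    have z05 := hQ0 0 5 (by decide)
    have z12 := hQ0 1 2 (by decide)
    have z15 := hQ0 1 5 (by decide)
    have z20 := hQ0 2 0 (by decide)
    have z21 := hQ0 2 1 (by decide)
    have z23 := hQ0 2 3 (by decide)
    have z24 := hQ0 2 4 (by decide)
    have z32 := hQ0 3 2 (by decide)
    have z35 := hQ0 3 5 (by decide)
    have z42 := hQ0 4 2 (by decide)
    have z45 := hQ0 4 5 (by decide)
    have z50 := hQ0 5 0 (by decide)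
    have z51 := hQ0 5 1 (by decide)
    have z53 := hQ0 5 3 (by decide)
    have z54 := hQ0 5 4 (by decide)
    have h01 := hentry 0 1
    have h10 := hentry 1 0
    have h34 := hentry 3 4
    have h43 := hentry 4 3
    have h03 := hentry 0 3
    have h30 := hentry 3 0
    have h14 := hentry 1 4
    have h41 := hentry 4 1
    -- Each hypothesis is named after the entry of `W` that it kills. At `(0, 4)` itself the
    -- commutation is vacuous, because the diagonal entries of the second matrix agree there; its
    -- entry at `(2, 0)` exposes `W 0 4` at position `(2, 4)` instead. The remaining choices work in
    -- the same way.
    have h04 := hentry 2 4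
    have h40 := hentry 4 2
    have h13 := hentry 1 5
    have h31 := hentry 5 1
    have h25 := hentry 0 5
    have h52 := hentry 5 0
    have h2 : GaussianInt.toComplex 2 = 2 := map_ofNat _ 2
    simp [h2, self_eq_neg, neg_eq_self, z02, z05, z12, z15, z20, z21, z23, z24, z32, z35, z42,
      z45, z50, z51, z53, z54] at h01 h10 h34 h43 h03 h30 h14 h41 h04 h40 h13 h31 h25 h52
    simp [h03] at h25
    simp [h30] at h52
    intro p q hpq
    fin_cases p <;> fin_cases q <;> first | exact absurd rfl hpq | assumption
  refine ⟨W 0 0, eq_smul_one hd 0 fun p => ?_⟩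
  have h03 : W 0 0 = W 3 3 := apply_self_eq_of_commute (hX 2) hd (by rw [hXdef]; decide +kernel)
  have h14 : W 1 1 = W 4 4 := apply_self_eq_of_commute (hX 2) hd (by rw [hXdef]; decide +kernel)
  have h25 : W 2 2 = W 5 5 := apply_self_eq_of_commute (hX 2) hd (by rw [hXdef]; decide +kernel)
  have h04 : W 0 0 = W 4 4 := apply_self_eq_of_commute (hX 0) hd (by rw [hXdef]; decide +kernel)
  have h15 : W 1 1 = W 5 5 := apply_self_eq_of_commute (hX 0) hd (by rw [hXdef]; decide +kernel)
  have h01 : W 0 0 = W 1 1 := h04.trans h14.symm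
  have h02 : W 0 0 = W 2 2 := h01.trans (h15.trans h25.symm)
  fin_cases p
  exacts [rfl, h01.symm, h02.symm, h03.symm, h04.symm, (h02.trans h25).symm]

end Commutant

/-! ### The off-diagonal block form. -/

section OffDiagonal

variable {g k : ℕ}

/-- The upper right block of a tuple of matrices of even size. -/
def upperRightBlock (X : MatTuple g (Fin (k + k))) : MatTuple g (Fin k) :=
  fun i => Matrix.of fun p q => X i (Fin.castAdd k p) (Fin.natAdd k q)

theorem offDiagonalTuple_upperRightBlock (r : ℕ)
    {X : Fin g → Matrix (Fin (k + k)) (Fin (k + k)) GaussianInt}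
    (h₁₁ : ∀ i p q, X i (Fin.castAdd k p) (Fin.castAdd k q) = 0)
    (h₂₂ : ∀ i p q, X i (Fin.natAdd k p) (Fin.natAdd k q) = 0)
    (h₂₁ : ∀ i p q, X i (Fin.natAdd k p) (Fin.castAdd k q) =
      star (X i (Fin.castAdd k p) (Fin.natAdd k q))) :
    offDiagonalTuple (upperRightBlock (scaledTuple r X)) = scaledTuple r X := by
  ext i p q
  refine Fin.addCases (fun p => ?_) (fun p => ?_) p <;>
    refine Fin.addCases (fun q => ?_) (fun q => ?_) q <;>
    simp [offDiagonalTuple, upperRightBlock, scaledTuple, complexMatrix, h₁₁, h₂₂, h₂₁,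
      GaussianInt.toComplex_star,
      -Fin.natAdd_eq_addNat]

theorem isSymm_upperRightBlock (r : ℕ)
    {X : Fin g → Matrix (Fin (k + k)) (Fin (k + k)) GaussianInt}
    (h : ∀ i p q, X i (Fin.castAdd k p) (Fin.natAdd k q) =
      X i (Fin.castAdd k q) (Fin.natAdd k p)) (i : Fin g) :
    (upperRightBlock (scaledTuple r X) i).IsSymm := by
  ext p q
  simp [upperRightBlock, scaledTuple, complexMatrix, h i p q, -Fin.natAdd_eq_addNat]

theorem exists_offDiagonalTuple_mem_freeExtremePoints (k : ℕ) (hk : k = 2 ∨ k = 3) :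
    ∃ C : MatTuple 3 (Fin k), (∀ i, (C i).IsSymm) ∧
      offDiagonalTuple C ∈ freeExtremePoints (freeSpectrahedron spinTriple) (k + k) := by
  rcases hk with rfl | rfl
  · refine ⟨upperRightBlock (scaledTuple 5 (phaseTuple coeffFour)),
      isSymm_upperRightBlock (k := 2) 5 (by decide +kernel), ?_⟩
    rw [offDiagonalTuple_upperRightBlock (k := 2) 5 (by decide +kernel) (by decide +kernel)
      (by decide +kernel)]
    exact mem_freeExtremePoints_freeSpectrahedron mem_freeSpectrahedron_four
      kernelNondegenerate_four trivialCommutant_four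
  · refine ⟨upperRightBlock (scaledTuple 3 (phaseTuple coeffSix)),
      isSymm_upperRightBlock (k := 3) 3 (by decide +kernel), ?_⟩
    rw [offDiagonalTuple_upperRightBlock (k := 3) 3 (by decide +kernel) (by decide +kernel)
      (by decide +kernel)]
    exact mem_freeExtremePoints_freeSpectrahedron mem_freeSpectrahedron_six
      kernelNondegenerate_six trivialCommutant_six

end OffDiagonal

/-! ### Completely positive maps and Choi matrices. -/

section CompletelyPositive

variable {ι κ m : Type} [Fintype ι] [DecidableEq ι] [Fintype κ] [DecidableEq κ] [Fintype m]
  [DecidableEq m]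

/-- A matrix of matrices, regarded as a matrix of scalars. -/
def flatten (M : CStarMatrix m m (Matrix ι ι ℂ)) : Matrix (m × ι) (m × ι) ℂ :=
  Matrix.of fun x y => M x.1 y.1 x.2 y.2

theorem flatten_star_mul_self {ι m : Type} [Fintype ι] [Fintype m]
    (S : CStarMatrix m m (Matrix ι ι ℂ)) :
    flatten (star S * S) = (flatten S)ᴴ * flatten S := by
  ext x y
  simp only [flatten, Matrix.of_apply, CStarMatrix.mul_apply, Matrix.sum_apply, Matrix.mul_apply,
    Fintype.sum_prod_type, Matrix.conjTranspose_apply]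
  rfl

/-- Flattening respects products and adjoints, and on both sides the positive elements are generated
by the squares `S* S`. -/
theorem nonneg_iff_posSemidef_flatten (M : CStarMatrix m m (Matrix ι ι ℂ)) :
    0 ≤ M ↔ (flatten M).PosSemidef := by
  constructor
  · intro h
    rw [StarOrderedRing.nonneg_iff] at h
    induction h using AddSubmonoid.closure_induction with
    | mem x hx =>
      obtain ⟨S, rfl⟩ := hx
      rw [flatten_star_mul_self]
      exact Matrix.posSemidef_conjTranspose_mul_self _
    | zero => exact Matrix.PosSemidef.zero
    | add x y _ _ hx hy => exact hx.add hy
  · intro h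
    obtain ⟨B, hB⟩ := CStarAlgebra.nonneg_iff_eq_star_mul_self.1 h.nonneg
    let S : CStarMatrix m m (Matrix ι ι ℂ) :=
      CStarMatrix.ofMatrix (Matrix.of fun p q => Matrix.of fun a b => B (p, a) (q, b))
    have hM : M = star S * S := by
      have h1 : flatten M = flatten (star S * S) := by
        rw [flatten_star_mul_self, hB]
        rfl
      ext p q a b
      exact congrFun (congrFun h1 (p, a)) (q, b)
    rw [hM]
    exact star_mul_self_nonneg S

/-- The linear map with Choi matrix `C`. -/
def choiMap (C : Matrix (ι × κ) (ι × κ) ℂ) : Matrix ι ι ℂ →ₗ[ℂ] Matrix κ κ ℂ where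
  toFun M := Matrix.of fun k l => ∑ a, ∑ b, M a b * C (a, k) (b, l)
  map_add' M N := by
    ext k l
    simp [add_mul, Finset.sum_add_distrib]
  map_smul' c M := by
    ext k l
    simp [Finset.mul_sum, mul_assoc]

theorem choiMap_apply {ι κ : Type} [Fintype ι] (C : Matrix (ι × κ) (ι × κ) ℂ)
    (M : Matrix ι ι ℂ) (k l : κ) :
    choiMap C M k l = ∑ a, ∑ b, M a b * C (a, k) (b, l) := rfl

/-- A factorization `C = G* G` gives a Kraus decomposition: each row of `G` is a Kraus operator, and
its amplification `W z` acts on the flattened matrix by compression. -/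
theorem posSemidef_flatten_map_choiMap {C : Matrix (ι × κ) (ι × κ) ℂ} (hC : C.PosSemidef)
    {M : CStarMatrix m m (Matrix ι ι ℂ)} (hM : (flatten M).PosSemidef) :
    (flatten (M.map (choiMap C))).PosSemidef := by
  obtain ⟨G, rfl⟩ := CStarAlgebra.nonneg_iff_eq_star_mul_self.1 hC.nonneg
  let W : ι × κ → Matrix (m × ι) (m × κ) ℂ := fun z =>
    Matrix.of fun x y => if x.1 = y.1 then G z (x.2, y.2) else 0
  have h : flatten (M.map (choiMap (star G * G))) = ∑ z, (W z)ᴴ * flatten M * W z := by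
    ext ⟨p, k⟩ ⟨q, l⟩
    simp only [flatten, Matrix.of_apply, CStarMatrix.map_apply, choiMap_apply, Matrix.sum_apply]
    have h1 : ∀ z, ((W z)ᴴ * flatten M * W z) (p, k) (q, l) =
        ∑ a, ∑ b, star (G z (a, k)) * M p q a b * G z (b, l) := by
      intro z
      simp [W, Matrix.mul_apply, Fintype.sum_prod_type, flatten, Matrix.conjTranspose_apply,
        apply_ite star, ite_mul, mul_ite, Finset.sum_mul]
      exact Finset.sum_comm
    have h2 : ∀ z, ((W z)ᴴ * (Matrix.of fun x y : m × ι => M x.1 y.1 x.2 y.2) * W z)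
        (p, k) (q, l) = ∑ a, ∑ b, star (G z (a, k)) * M p q a b * G z (b, l) := h1
    simp only [h2]
    symm
    rw [Finset.sum_comm]
    refine Finset.sum_congr rfl fun a _ => ?_
    rw [Finset.sum_comm]
    refine Finset.sum_congr rfl fun b _ => ?_
    rw [Matrix.mul_apply, Finset.mul_sum]
    refine Finset.sum_congr rfl fun z _ => ?_
    rw [Matrix.star_apply]
    ring
  rw [h]
  exact Matrix.posSemidef_sum _ fun z _ => hM.conjTranspose_mul_mul_same _

/-- The completely positive map with a given positive semidefinite Choi matrix. -/
def choiCP {C : Matrix (ι × κ) (ι × κ) ℂ} (hC : C.PosSemidef) :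
    Matrix ι ι ℂ →CP Matrix κ κ ℂ where
  toLinearMap := choiMap C
  map_cstarMatrix_nonneg' _ _ hM :=
    (nonneg_iff_posSemidef_flatten _).2
      (posSemidef_flatten_map_choiMap hC ((nonneg_iff_posSemidef_flatten _).1 hM))

theorem mem_matrixRange_of_choiMap {g n : ℕ} (hn : 0 < n) {A : MatTuple g ι}
    {X : MatTuple g (Fin n)} {C : Matrix (ι × Fin n) (ι × Fin n) ℂ} (hC : C.PosSemidef)
    (h1 : choiMap C 1 = 1) (hX : ∀ i, choiMap C (A i) = X i) : X ∈ matrixRange A n :=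
  ⟨hn, choiCP hC, h1, hX⟩

theorem isHermitian_map (φ : Matrix ι ι ℂ →CP Matrix κ κ ℂ) {A : Matrix ι ι ℂ}
    (hA : A.IsHermitian) : (φ A).IsHermitian := by
  obtain ⟨b, c, hb, hc, hbc⟩ := IsSelfAdjoint.exists_nonneg_sub_nonneg
    (show IsSelfAdjoint A from hA)
  rw [hbc, map_sub]
  exact (Matrix.nonneg_iff_posSemidef.1 (map_nonneg φ hb)).1.sub
    (Matrix.nonneg_iff_posSemidef.1 (map_nonneg φ hc)).1

/-- Applying `φ` entrywise to the positive matrix `L_A(Y)`, with the tensor factors swapped, yields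
`L_Y(φ(A))`. -/
theorem matrixRange_le_freePolarDual {g : ℕ} {A : MatTuple g ι} (hA : ∀ i, (A i).IsHermitian) :
    matrixRange A ≤ freePolarDual (freeSpectrahedron A) := by
  rintro n X ⟨hn, φ, hφ, hX⟩
  have key : ∀ (m : ℕ) (Y : MatTuple g (Fin m)), (monicPencil A Y).PosSemidef →
      (monicPencil Y X).PosSemidef := by
    intro m Y hY
    let M : CStarMatrix (Fin m) (Fin m) (Matrix ι ι ℂ) := CStarMatrix.ofMatrix
      (Matrix.of fun p q => (1 : Matrix (Fin m) (Fin m) ℂ) p q • (1 : Matrix ι ι ℂ) -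
        ∑ i, Y i p q • A i)
    have hM : 0 ≤ M := by
      rw [nonneg_iff_posSemidef_flatten]
      convert hY.submatrix (Prod.swap : Fin m × ι → ι × Fin m) using 1
      ext ⟨p, a⟩ ⟨q, b⟩
      simp only [flatten, M, monicPencil, Matrix.of_apply, Matrix.submatrix_apply,
        CStarMatrix.ofMatrix_apply, Matrix.sub_apply, Matrix.sum_apply, Matrix.smul_apply,
        Matrix.kroneckerMap_apply, Prod.swap_prod_mk, smul_eq_mul]
      congr 1
      · simp [Matrix.one_apply, Prod.ext_iff, ← ite_and]
      · exact Finset.sum_congr rfl fun i _ => mul_comm _ _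
    have := (nonneg_iff_posSemidef_flatten _).1 (φ.map_cstarMatrix_nonneg M hM)
    convert this using 1
    ext ⟨p, k⟩ ⟨q, l⟩
    simp only [flatten, M, monicPencil, Matrix.of_apply, CStarMatrix.map_apply,
      CStarMatrix.ofMatrix_apply, map_sub, map_sum, map_smul, hφ, hX, Matrix.sub_apply,
      Matrix.sum_apply, Matrix.smul_apply, Matrix.kroneckerMap_apply, smul_eq_mul]
    congr 1
    simp [Matrix.one_apply, Prod.ext_iff, ← ite_and, and_comm]
  refine ⟨hn, fun i => ?_, fun m Y hY => key m Y hY.2.2⟩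
  rw [← hX]
  exact isHermitian_map φ (hA i)

end CompletelyPositive

/-! ### Compactness for the separation argument. -/

section ConvexHull

/-- The convex hull of a compact set in a finite-dimensional space is compact. -/
theorem isCompact_convexHull {E : Type} [AddCommGroup E] [Module ℝ E] [TopologicalSpace E]
    [IsTopologicalAddGroup E] [ContinuousSMul ℝ E] [FiniteDimensional ℝ E] {s : Set E}
    (hs : IsCompact s) : IsCompact (convexHull ℝ s) := by
  rcases s.eq_empty_or_nonempty with rfl | ⟨z₀, hz₀⟩
  · simp
  -- By Carathéodory's theorem `N` points suffice, so the hull is a continuous image of a compact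
  -- product.
  let N := Module.finrank ℝ E + 1
  let Φ : (Fin N → ℝ) × (Fin N → E) → E := fun x => ∑ j, x.1 j • x.2 j
  have hΦ : Continuous Φ := by fun_prop
  have himage : Φ '' (stdSimplex ℝ (Fin N) ×ˢ Set.univ.pi fun _ => s) = convexHull ℝ s := by
    apply Set.Subset.antisymm
    · rintro _ ⟨⟨w, z⟩, ⟨hw, hz⟩, rfl⟩
      exact (convex_convexHull ℝ s).sum_mem (fun j _ => hw.1 j) hw.2
        fun j _ => subset_convexHull ℝ s (hz j trivial)
    · intro x hx
      obtain ⟨ι, _, z, w, hz, hind, hw, hw1, rfl⟩ := eq_pos_convex_span_of_mem_convexHull hx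
      have hcard : Fintype.card ι ≤ Fintype.card (Fin N) := by
        rw [Fintype.card_fin]
        exact hind.card_le_finrank_succ.trans
          (Nat.succ_le_succ (Submodule.finrank_le _))
      obtain ⟨e⟩ := Function.Embedding.nonempty_of_card_le hcard
      classical
      have hsum : ∀ {M : Type} [AddCommMonoid M] (f : ι → M),
          ∑ j, Function.extend e f 0 j = ∑ i, f i := by
        intro M _ f
        rw [← Finset.sum_subset (Finset.subset_univ (Finset.univ.map e)), Finset.sum_map]
        · exact Finset.sum_congr rfl fun i _ => e.injective.extend_apply f 0 i
        · intro j _ hj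
          rw [Function.extend_apply']
          · rfl
          · rintro ⟨i, rfl⟩
            exact hj (Finset.mem_map_of_mem e (Finset.mem_univ i))
      -- Unused slots get weight `0` and the dummy point `z₀` of `s`.
      refine ⟨(Function.extend e w 0, Function.extend e z fun _ => z₀), ⟨⟨fun j => ?_, ?_⟩, ?_⟩, ?_⟩
      · by_cases hj : ∃ i, e i = j
        · obtain ⟨i, rfl⟩ := hj
          exact (hw i).le.trans_eq (e.injective.extend_apply w (0 : Fin N → ℝ) i).symm
        · exact (Function.extend_apply' w (0 : Fin N → ℝ) j hj).ge
      · rw [hsum, hw1]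
      · intro j _
        by_cases hj : ∃ i, e i = j
        · obtain ⟨i, rfl⟩ := hj
          simp only [e.injective.extend_apply]
          exact hz ⟨i, rfl⟩
        · simp only [Function.extend_apply' _ _ _ hj]
          exact hz₀
      · rw [← hsum]
        refine Finset.sum_congr rfl fun j _ => ?_
        by_cases hj : ∃ i, e i = j
        · obtain ⟨i, rfl⟩ := hj
          simp only [e.injective.extend_apply]
        · simp only [Function.extend_apply' _ _ _ hj, Pi.zero_apply, zero_smul]
  rw [← himage]
  exact ((isCompact_stdSimplex ℝ (Fin N)).prod (isCompact_univ_pi fun _ => hs)).image hΦ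

/-- The positive semidefinite matrices of trace one form a compact set. -/
theorem isCompact_posSemidef_trace_one {κ : Type} [Fintype κ] [DecidableEq κ] :
    IsCompact {P : Matrix κ κ ℂ | P.PosSemidef ∧ P.trace = 1} := by
  -- This is the Hilbert–Schmidt unit sphere; the set in question is its image under `B ↦ Bᴴ * B`.
  have hB : IsCompact {B : Matrix κ κ ℂ | (Bᴴ * B).trace = 1} := by
    have h1 : IsCompact (Set.univ.pi fun _ : κ => Set.univ.pi fun _ : κ =>
        Metric.closedBall (0 : ℂ) 1) :=
      isCompact_univ_pi fun _ => isCompact_univ_pi fun _ => isCompact_closedBall 0 1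
    refine h1.of_isClosed_subset ?_ ?_
    · have hc : Continuous fun B : Matrix κ κ ℂ => (Bᴴ * B).trace := by
        refine Continuous.matrix_trace ?_
        exact (continuous_id.matrix_conjTranspose).matrix_mul continuous_id
      exact isClosed_singleton.preimage hc
    · intro (B : Matrix κ κ ℂ) (hB : (Bᴴ * B).trace = 1) i _ j _
      have h2 : ∑ p, ∑ q, ‖B q p‖ ^ 2 = 1 := by
        have := congrArg Complex.re hB
        simpa only [Matrix.trace, Matrix.diag_apply, Matrix.mul_apply, Matrix.conjTranspose_apply,
          Complex.re_sum, Complex.one_re, Complex.star_def, ← Complex.normSq_eq_conj_mul_self,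
          Complex.ofReal_re, Complex.normSq_eq_norm_sq] using this
      have h3 : ‖B i j‖ ^ 2 ≤ 1 := by
        rw [← h2]
        exact (Finset.single_le_sum (f := fun q => ‖B q j‖ ^ 2) (fun _ _ => sq_nonneg _)
          (Finset.mem_univ i)).trans (Finset.single_le_sum (f := fun p => ∑ q, ‖B q p‖ ^ 2)
          (fun _ _ => Finset.sum_nonneg fun _ _ => sq_nonneg _) (Finset.mem_univ j))
      rw [mem_closedBall_zero_iff]
      exact (sq_le_one_iff₀ (norm_nonneg _)).1 h3
  have hc : Continuous fun B : Matrix κ κ ℂ => Bᴴ * B :=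
    (continuous_id.matrix_conjTranspose).matrix_mul continuous_id
  convert hB.image hc using 1
  ext P
  constructor
  · rintro ⟨hP, h1⟩
    obtain ⟨B, rfl⟩ := CStarAlgebra.nonneg_iff_eq_star_mul_self.1 hP.nonneg
    exact ⟨B, h1, rfl⟩
  · rintro ⟨B, h1, rfl⟩
    exact ⟨Matrix.posSemidef_conjTranspose_mul_self B, h1⟩

end ConvexHull

/-! ### Hahn–Banach separation by a monic pencil. -/

section Separation

variable {κ : Type} [Fintype κ] [DecidableEq κ]

/-- On Hermitian matrices, a real functional is given by a Hermitian matrix. -/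
theorem exists_isHermitian_eq_trace (f : Matrix κ κ ℂ →ₗ[ℝ] ℝ) :
    ∃ B : Matrix κ κ ℂ, B.IsHermitian ∧ ∀ P : Matrix κ κ ℂ, P.IsHermitian →
      f P = (B * P).trace.re := by
  let F : Matrix κ κ ℂ →ₗ[ℂ] ℂ := Module.Dual.extendRCLike (𝕜 := ℂ) f
  have hF : ∀ P, (F P).re = f P := by
    intro P
    simp [F, Module.Dual.extendRCLike_apply]
  let A : Matrix κ κ ℂ := Matrix.of fun q p => F (Matrix.single p q 1)
  have hA : ∀ P, F P = (A * P).trace := by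
    intro P
    conv_lhs => rw [Matrix.matrix_eq_sum_single P]
    simp only [map_sum]
    rw [Matrix.trace, Finset.sum_comm]
    refine Finset.sum_congr rfl fun q _ => ?_
    rw [Matrix.diag_apply, Matrix.mul_apply]
    refine Finset.sum_congr rfl fun p _ => ?_
    have : Matrix.single p q (P p q) = P p q • Matrix.single p q (1 : ℂ) := by
      rw [Matrix.smul_single, smul_eq_mul, mul_one]
    rw [this, map_smul, smul_eq_mul, mul_comm]
    rfl
  refine ⟨(2 : ℂ)⁻¹ • (A + Aᴴ), ?_, fun P hP => ?_⟩
  · rw [Matrix.IsHermitian, Matrix.conjTranspose_smul, Matrix.conjTranspose_add,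
      Matrix.conjTranspose_conjTranspose, add_comm]
    simp
  · have h1 : (Aᴴ * P).trace = star (A * P).trace := by
      rw [← Matrix.trace_conjTranspose, Matrix.conjTranspose_mul, hP.eq, Matrix.trace_mul_comm]
    rw [← hF, hA, Matrix.smul_mul, Matrix.trace_smul, Matrix.add_mul, Matrix.trace_add, h1]
    have h2 : (2 : ℂ)⁻¹ • ((A * P).trace + star (A * P).trace) = ((A * P).trace.re : ℂ) := by
      rw [Complex.star_def, Complex.add_conj, smul_eq_mul]
      push_cast
      ring
    rw [h2, Complex.ofReal_re]

theorem star_vec_dotProduct_monicPencil_mulVec {g : ℕ} (Y X : MatTuple g κ) (R : Matrix κ κ ℂ) :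
    star (Matrix.vec R) ⬝ᵥ (monicPencil Y X *ᵥ Matrix.vec R) =
      (Rᴴ * R).trace - ∑ i, (Rᴴ * (X i * R * (Y i)ᵀ)).trace := by
  rw [monicPencil_mulVec, dotProduct_sub, dotProduct_sum, Matrix.star_vec_dotProduct_vec]
  simp only [Matrix.kronecker_mulVec_vec, Matrix.star_vec_dotProduct_vec]

/-- Separation of `(1, X)` from the sums of elements of a cone of Hermitian tuples with a compact
base which is invariant under congruences, by a monic pencil. -/
theorem exists_separating_pencil {g : ℕ} [Nonempty κ] (G : Set (Matrix κ κ ℂ × MatTuple g κ))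
    (hcomp : IsCompact {x ∈ G | x.1.trace = 1})
    (hsmul : ∀ x ∈ G, ∀ t : ℝ, 0 ≤ t → t • x ∈ G)
    (hpos : ∀ x ∈ G, x.1.PosSemidef ∧ ∀ i, (x.2 i).IsHermitian)
    (hzero : ∀ x ∈ G, x.1 = 0 → x = 0)
    (hdiag : ∀ P : Matrix κ κ ℂ, P.PosSemidef → (P, 0) ∈ G)
    (hcongr : ∀ x ∈ G, ∀ R : Matrix κ κ ℂ, R.IsHermitian →
      (R * x.1 * R, fun i => R * x.2 i * R) ∈ G)
    {X : MatTuple g κ} (hXh : ∀ i, (X i).IsHermitian)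
    (hX : ¬ ∃ (J : Type) (_ : Fintype J) (x : J → Matrix κ κ ℂ × MatTuple g κ),
      (∀ j, x j ∈ G) ∧ ∑ j, x j = (1, X)) :
    ∃ Y : MatTuple g κ, (∀ i, (Y i).IsHermitian) ∧
      (∀ x ∈ G, ∑ i, ((Y i)ᵀ * x.2 i).trace.re ≤ x.1.trace.re) ∧
      ¬ (monicPencil Y X).PosSemidef := by
  set c : ℝ := (Fintype.card κ : ℝ) with hc
  have hc0 : 0 < c := by
    rw [hc]
    exact_mod_cast Fintype.card_pos
  let S := {x ∈ G | x.1.trace = 1}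
  -- The factor `c⁻¹` brings the first component to trace one. `G` itself need not be convex: a
  -- convex combination from `S` rescales to a sum of elements of `G`.
  have hnot : c⁻¹ • ((1 : Matrix κ κ ℂ), X) ∉ convexHull ℝ S := by
    intro hmem
    obtain ⟨J, _, z, w, hz, -, hw, -, hsum⟩ := eq_pos_convex_span_of_mem_convexHull hmem
    refine hX ⟨J, inferInstance, fun j => c • w j • z j, fun j => ?_, ?_⟩
    · exact hsmul _ (hsmul _ (hz ⟨j, rfl⟩).1 _ (hw j).le) _ hc0.le
    · rw [← Finset.smul_sum, hsum, smul_smul, mul_inv_cancel₀ hc0.ne', one_smul]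
  obtain ⟨f, u, hfu, hu⟩ := geometric_hahn_banach_point_closed (convex_convexHull ℝ S)
    (isCompact_convexHull hcomp).isClosed hnot
  obtain ⟨B₀, hB₀, hfB₀⟩ := exists_isHermitian_eq_trace
    (f.toLinearMap ∘ₗ LinearMap.inl ℝ (Matrix κ κ ℂ) (MatTuple g κ))
  have hrep : ∀ i, ∃ B : Matrix κ κ ℂ, B.IsHermitian ∧ ∀ P : Matrix κ κ ℂ, P.IsHermitian →
      (f.toLinearMap ∘ₗ LinearMap.inr ℝ (Matrix κ κ ℂ) (MatTuple g κ) ∘ₗ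
        LinearMap.single ℝ (fun _ => Matrix κ κ ℂ) i) P = (B * P).trace.re :=
    fun i => exists_isHermitian_eq_trace _
  choose B hB hfB using hrep
  have hf : ∀ x : Matrix κ κ ℂ × MatTuple g κ, x.1.IsHermitian → (∀ i, (x.2 i).IsHermitian) →
      f x = (B₀ * x.1).trace.re + ∑ i, (B i * x.2 i).trace.re := by
    rintro ⟨P, Q⟩ hP hQ
    have h1 : f (P, Q) = f (LinearMap.inl ℝ _ _ P) +
        ∑ i, f (LinearMap.inr ℝ (Matrix κ κ ℂ) (MatTuple g κ)
          (LinearMap.single ℝ (fun _ => Matrix κ κ ℂ) i (Q i))) := by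
      rw [← map_sum, ← map_add, ← map_sum]
      congr 1
      rw [LinearMap.inl_apply, LinearMap.inr_apply, Prod.mk_add_mk, add_zero, zero_add]
      congr 1
      exact (Finset.univ_sum_single Q).symm
    rw [h1]
    exact congrArg₂ _ (hfB₀ P hP) (Finset.sum_congr rfl fun i _ => hfB i _ (hQ i))
  -- On the base the threshold `u` equals `u · tr P`. Absorbing it makes the functional strictly
  -- positive on `S` and negative at `(1, X)`.
  let B' : Matrix κ κ ℂ := B₀ - (u : ℂ) • 1
  have hB' : ∀ P : Matrix κ κ ℂ, (B' * P).trace.re = (B₀ * P).trace.re - u * P.trace.re := by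
    intro P
    simp [B', Matrix.sub_mul]
  have hpos' : ∀ x ∈ S, 0 < (B' * x.1).trace.re + ∑ i, (B i * x.2 i).trace.re := by
    intro x hx
    have h1 := hu x (subset_convexHull ℝ S hx)
    rw [hf x (hpos x hx.1).1.1 (hpos x hx.1).2] at h1
    rw [hB', hx.2, Complex.one_re]
    linarith
  have hposG : ∀ x ∈ G, x.1 ≠ 0 → 0 < (B' * x.1).trace.re + ∑ i, (B i * x.2 i).trace.re := by
    intro x hx hx0
    have hP := (hpos x hx).1
    obtain ⟨t, ht⟩ : ∃ t : ℝ, (t : ℂ) = x.1.trace := ⟨x.1.trace.re, by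
      have := Complex.le_def.1 hP.trace_nonneg
      apply Complex.ext <;> simp [← this.2]⟩
    have ht0 : 0 ≤ t := by
      have := hP.trace_nonneg
      rw [← ht] at this
      exact_mod_cast this
    have htpos : 0 < t := lt_of_le_of_ne ht0 (by
      rintro rfl
      exact hx0 (hP.trace_eq_zero_iff.1 (by rw [← ht, Complex.ofReal_zero])))
    have h1 := hpos' (t⁻¹ • x) ⟨hsmul x hx _ (inv_nonneg.2 ht0), by
      rw [Prod.smul_fst, Matrix.trace_smul, ← ht, Complex.real_smul, ← Complex.ofReal_mul,
        inv_mul_cancel₀ htpos.ne', Complex.ofReal_one]⟩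
    have h2 : (B' * (t⁻¹ • x).1).trace.re + ∑ i, (B i * (t⁻¹ • x).2 i).trace.re =
        t⁻¹ * ((B' * x.1).trace.re + ∑ i, (B i * x.2 i).trace.re) := by
      simp [mul_add, Finset.mul_sum]
    rw [h2] at h1
    exact pos_of_mul_pos_right h1 (inv_nonneg.2 ht0)
  have hnonneg : ∀ x ∈ G, 0 ≤ (B' * x.1).trace.re + ∑ i, (B i * x.2 i).trace.re := by
    intro x hx
    by_cases hx0 : x.1 = 0
    · rw [hzero x hx hx0]
      simp
    · exact (hposG x hx hx0).le
  have hneg : (B' * 1).trace.re + ∑ i, (B i * X i).trace.re < 0 := by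
    have h1 : f (c⁻¹ • ((1 : Matrix κ κ ℂ), X)) < u := hfu
    rw [map_smul, hf _ Matrix.isHermitian_one hXh, smul_eq_mul, inv_mul_lt_iff₀ hc0] at h1
    rw [hB', Matrix.trace_one, Complex.natCast_re, ← hc]
    linarith
  have hB'h : B'.IsHermitian := by
    refine hB₀.sub ?_
    rw [Matrix.IsHermitian, Matrix.conjTranspose_smul, Matrix.conjTranspose_one, Complex.star_def,
      Complex.conj_ofReal]
  -- Test on the elements `(v v*, 0)` of `G`; strictness of the separation gives definiteness.
  have hB'pos : B'.PosDef := by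
    refine Matrix.PosDef.of_dotProduct_mulVec_pos hB'h fun v hv => ?_
    have h1 := hposG _ (hdiag _ (Matrix.posSemidef_vecMulVec_self_star v)) fun h => hv (by
      have := congrArg Matrix.trace h
      rwa [Matrix.trace_vecMulVec, Matrix.trace_zero, dotProduct_comm,
          dotProduct_star_self_eq_zero] at this)
    simp only [Pi.zero_apply, Matrix.mul_zero, Matrix.trace_zero, Complex.zero_re,
      Finset.sum_const_zero, add_zero, Matrix.mul_vecMulVec, Matrix.trace_vecMulVec] at h1
    rw [dotProduct_comm] at h1
    exact Complex.lt_def.2 ⟨h1, (hB'h.im_star_dotProduct_mulVec_self v).symm⟩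
  -- Congruence by `B'^(-1/2)`, under which `G` is invariant, normalizes the leading coefficient to
  -- `1`; this makes the pencil monic.
  let R₀ := CFC.sqrt B'
  have hR₀ : R₀ * R₀ = B' := CFC.sqrt_mul_sqrt_self B' hB'pos.posSemidef.nonneg
  have hR₀h : R₀ᴴ = R₀ := (Matrix.nonneg_iff_posSemidef.1 (CFC.sqrt_nonneg B')).1
  have hdet : IsUnit R₀.det := by
    have h1 := (Matrix.isUnit_iff_isUnit_det _).1 hB'pos.isUnit
    rw [← hR₀, Matrix.det_mul] at h1
    exact isUnit_of_mul_isUnit_left h1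
  have hR₁ : R₀ * R₀⁻¹ = 1 := Matrix.mul_nonsing_inv _ hdet
  have hR₂ : R₀⁻¹ * R₀ = 1 := Matrix.nonsing_inv_mul _ hdet
  set R := R₀⁻¹ with hR
  have hRh : Rᴴ = R := by rw [hR, Matrix.conjTranspose_nonsing_inv, hR₀h]
  refine ⟨fun i => -(R * B i * R)ᵀ, fun i => ?_, fun x hx => ?_, fun hps => ?_⟩
  · refine Matrix.IsHermitian.neg (Matrix.IsHermitian.transpose ?_)
    rw [Matrix.IsHermitian, Matrix.conjTranspose_mul, Matrix.conjTranspose_mul, hRh, (hB i).eq,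
      Matrix.mul_assoc]
  · have h1 := hnonneg _ (hcongr x hx R hRh)
    have h2 : (B' * (R * x.1 * R)).trace = x.1.trace := by
      rw [← hR₀, ← Matrix.mul_assoc, ← Matrix.mul_assoc, Matrix.mul_assoc R₀ R₀ R, hR₁,
        Matrix.mul_one, Matrix.trace_mul_comm, ← Matrix.mul_assoc, hR₂, Matrix.one_mul]
    have h3 : ∀ i, ((-(R * B i * R)ᵀ)ᵀ * x.2 i).trace.re = -(B i * (R * x.2 i * R)).trace.re := by
      intro i
      rw [Matrix.transpose_neg, Matrix.transpose_transpose, Matrix.neg_mul, Matrix.trace_neg,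
        Complex.neg_re, Matrix.mul_assoc, Matrix.mul_assoc, Matrix.trace_mul_comm,
        Matrix.mul_assoc, Matrix.mul_assoc]
    simp only [h2] at h1
    simp only [h3, Finset.sum_neg_distrib]
    linarith
  -- At the vector `vec R₀` the form of `L_Y(X)` takes the value `tr B' + ∑ᵢ tr(Bᵢ Xᵢ)`, which is
  -- negative.
  · have h1 := hps.dotProduct_mulVec_nonneg (Matrix.vec R₀)
    rw [star_vec_dotProduct_monicPencil_mulVec, hR₀h, hR₀] at h1
    have h2 : ∀ i, (R₀ * (X i * R₀ * (-(R * B i * R)ᵀ)ᵀ)).trace = -(B i * X i).trace := by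
      intro i
      rw [Matrix.transpose_neg, Matrix.transpose_transpose, Matrix.mul_neg, Matrix.mul_neg,
        Matrix.trace_neg]
      have : R₀ * (X i * R₀ * (R * B i * R)) = R₀ * (X i * (R₀ * R) * B i * R) := by
        simp only [Matrix.mul_assoc]
      rw [this, hR₁, Matrix.mul_one, Matrix.trace_mul_comm, Matrix.mul_assoc, hR₂, Matrix.mul_one,
        Matrix.trace_mul_comm]
    simp only [h2, Finset.sum_neg_distrib, sub_neg_eq_add] at h1
    have h3 := (Complex.le_def.1 h1).1
    rw [Complex.add_re, Complex.re_sum, Complex.zero_re] at h3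
    rw [Matrix.mul_one] at hneg
    linarith

end Separation

/-! ### The polar dual of a free spectrahedron. -/

section PolarDual

variable {ι κ : Type} [Fintype ι] [DecidableEq ι] [Fintype κ] [DecidableEq κ]

theorem trace_choiMap_one {ι κ : Type} [Fintype ι] [DecidableEq ι] [Fintype κ]
    (C : Matrix (ι × κ) (ι × κ) ℂ) : (choiMap C 1).trace = C.trace := by
  simp only [Matrix.trace, Matrix.diag_apply, choiMap_apply, Matrix.one_apply, ite_mul, one_mul,
    zero_mul, Finset.sum_ite_eq, Finset.mem_univ, if_true, Fintype.sum_prod_type]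
  exact Finset.sum_comm

theorem choiMap_smul {ι κ : Type} [Fintype ι]
    (t : ℝ) (C : Matrix (ι × κ) (ι × κ) ℂ) (M : Matrix ι ι ℂ) :
    choiMap (t • C) M = t • choiMap C M := by
  ext k l
  simp [choiMap_apply, Finset.mul_sum, mul_left_comm]

theorem choiMap_sum {ι κ : Type} [Fintype ι]
    {J : Type} [Fintype J] (C : J → Matrix (ι × κ) (ι × κ) ℂ)
    (M : Matrix ι ι ℂ) : choiMap (∑ j, C j) M = ∑ j, choiMap (C j) M := by
  ext k l
  simp only [choiMap_apply, Matrix.sum_apply, Finset.mul_sum]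
  symm
  rw [Finset.sum_comm]
  refine Finset.sum_congr rfl fun a _ => ?_
  rw [Finset.sum_comm]

theorem choiMap_zero {ι κ : Type} [Fintype ι]
    (M : Matrix ι ι ℂ) : choiMap (0 : Matrix (ι × κ) (ι × κ) ℂ) M = 0 := by
  ext k l
  simp [choiMap_apply]

theorem choiMap_one_kronecker {ι κ : Type} [Fintype ι] [DecidableEq ι]
    (P : Matrix κ κ ℂ) (M : Matrix ι ι ℂ) :
    choiMap ((1 : Matrix ι ι ℂ) ⊗ₖ P) M = M.trace • P := by
  ext k l
  simp [choiMap_apply, Matrix.one_apply, Matrix.trace, Finset.sum_mul]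

theorem choiMap_congr {ι κ : Type} [Fintype ι] [DecidableEq ι] [Fintype κ]
    (C : Matrix (ι × κ) (ι × κ) ℂ) (R : Matrix κ κ ℂ) (M : Matrix ι ι ℂ) :
    choiMap (((1 : Matrix ι ι ℂ) ⊗ₖ R)ᴴ * C * ((1 : Matrix ι ι ℂ) ⊗ₖ R)) M =
      Rᴴ * choiMap C M * R := by
  have h : ∀ a b k l, (((1 : Matrix ι ι ℂ) ⊗ₖ R)ᴴ * C * ((1 : Matrix ι ι ℂ) ⊗ₖ R)) (a, k) (b, l) =
      (Rᴴ * (Matrix.of fun p q => C (a, p) (b, q)) * R) k l := by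
    intro a b k l
    simp [Matrix.mul_apply, Fintype.sum_prod_type, Matrix.conjTranspose_apply, Matrix.one_apply,
      Finset.sum_mul, apply_ite star]
  have h2 : choiMap C M = ∑ a, ∑ b, M a b • Matrix.of fun p q => C (a, p) (b, q) := by
    ext k l
    simp [choiMap_apply, Matrix.sum_apply]
  rw [h2]
  simp only [Matrix.mul_sum, Matrix.sum_mul, Matrix.mul_smul, Matrix.smul_mul]
  ext k l
  simp only [choiMap_apply, h, Matrix.sum_apply, Matrix.smul_apply, smul_eq_mul]

theorem star_dotProduct_kronecker_mulVec {ι κ : Type} [Fintype ι] [Fintype κ]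
    (A : Matrix ι ι ℂ) (Y : Matrix κ κ ℂ) (w : ι × κ → ℂ) :
    star w ⬝ᵥ ((A ⊗ₖ Y) *ᵥ w) =
      (Yᵀ * choiMap (Matrix.vecMulVec (star w) w) A).trace := by
  simp only [dotProduct, kronecker_mulVec_apply, Fintype.sum_prod_type, Matrix.trace,
    Matrix.diag_apply, Matrix.mul_apply, choiMap_apply, Matrix.vecMulVec_apply, Finset.mul_sum,
    Matrix.transpose_apply, Pi.star_apply]
  have h1 (f : ι → κ → ι → κ → ℂ) : ∑ a, ∑ k, ∑ b, ∑ l, f a k b l =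
      ∑ l, ∑ k, ∑ a, ∑ b, f a k b l := by
    calc _ = ∑ k, ∑ a, ∑ b, ∑ l, f a k b l := Finset.sum_comm
      _ = ∑ k, ∑ l, ∑ a, ∑ b, f a k b l := by
        refine Finset.sum_congr rfl fun k _ => ?_
        rw [Finset.sum_comm (s := (Finset.univ : Finset κ))]
        exact Finset.sum_congr rfl fun a _ => Finset.sum_comm
      _ = _ := Finset.sum_comm
  rw [h1]
  refine Finset.sum_congr rfl fun l _ => Finset.sum_congr rfl fun k _ =>
    Finset.sum_congr rfl fun a _ => Finset.sum_congr rfl fun b _ => ?_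
  ring

/-- The cone of all `(φ(1), φ(A))` with `φ` completely positive contains `(1, X)` exactly when `X ∈
W(A)`. Otherwise a pencil `L_Y` separates; its positivity on rank one Choi matrices says `Y ∈ D_A`,
while `L_Y(X)` is not positive. -/
theorem freePolarDual_freeSpectrahedron_le {g : ℕ} [Nonempty ι] {A : MatTuple g ι}
    (hA : ∀ i, (A i).IsHermitian) (htr : ∀ i, (A i).trace = 0) :
    freePolarDual (freeSpectrahedron A) ≤ matrixRange A := by
  rintro n X ⟨hn, hXh, hX⟩
  by_contra hXA
  have : Nonempty (Fin n) := ⟨⟨0, hn⟩⟩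
  let Φ : Matrix (ι × Fin n) (ι × Fin n) ℂ → Matrix (Fin n) (Fin n) ℂ × MatTuple g (Fin n) :=
    fun C => (choiMap C 1, fun i => choiMap C (A i))
  have hΦ : Continuous Φ := by
    have h : ∀ M : Matrix ι ι ℂ, Continuous fun C : Matrix (ι × Fin n) (ι × Fin n) ℂ =>
        choiMap C M := by
      intro M
      refine continuous_matrix fun k l => ?_
      simp only [choiMap_apply]
      exact continuous_finsetSum _ fun a _ => continuous_finsetSum _ fun b _ =>
        continuous_const.mul (continuous_id.matrix_elem _ _)
    exact (h 1).prodMk (continuous_pi fun i => h (A i))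
  let G : Set (Matrix (Fin n) (Fin n) ℂ × MatTuple g (Fin n)) :=
    Φ '' {C | C.PosSemidef}
  refine Exists.elim (exists_separating_pencil G (X := X) ?_ ?_ ?_ ?_ ?_ ?_ hXh ?_) ?_
  · convert (isCompact_posSemidef_trace_one (κ := ι × Fin n)).image hΦ using 1
    ext x
    constructor
    · rintro ⟨⟨C, hC, rfl⟩, h⟩
      exact ⟨C, ⟨hC, by rw [← trace_choiMap_one]; exact h⟩, rfl⟩
    · rintro ⟨C, ⟨hC, h⟩, rfl⟩
      exact ⟨⟨C, hC, rfl⟩, (trace_choiMap_one C).trans h⟩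
  · rintro _ ⟨C, hC, rfl⟩ t ht
    refine ⟨t • C, Matrix.PosSemidef.smul hC ht, ?_⟩
    simp only [Φ, choiMap_smul]
    rfl
  · rintro _ ⟨C, hC, rfl⟩
    exact ⟨Matrix.nonneg_iff_posSemidef.1 (map_nonneg (choiCP hC)
      (Matrix.nonneg_iff_posSemidef.2 Matrix.PosSemidef.one)),
      fun i => isHermitian_map (choiCP hC) (hA i)⟩
  · rintro _ ⟨C, hC, rfl⟩ h0
    have h1 : C.trace = 0 := by
      rw [← trace_choiMap_one, show choiMap C 1 = 0 from h0, Matrix.trace_zero]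
    rw [hC.trace_eq_zero_iff.1 h1]
    simp only [Φ, choiMap_zero]
    rfl
  -- The map `M ↦ tr(M) P / card ι` sends `1` to `P` and, by tracelessness, each `A i` to `0`.
  · intro P hP
    have hd : ((Fintype.card ι : ℝ)⁻¹ : ℝ) • (Fintype.card ι : ℂ) = 1 := by
      rw [Complex.real_smul]
      push_cast
      exact inv_mul_cancel₀ (Nat.cast_ne_zero.2 Fintype.card_ne_zero)
    refine ⟨(Fintype.card ι : ℝ)⁻¹ • ((1 : Matrix ι ι ℂ) ⊗ₖ P),
      Matrix.PosSemidef.smul (Matrix.PosSemidef.one.kronecker hP) (by positivity), ?_⟩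
    simp only [Φ, choiMap_smul, choiMap_one_kronecker, htr, Matrix.trace_one, zero_smul,
      smul_zero, ← smul_assoc, hd, one_smul]
    rfl
  · rintro _ ⟨C, hC, rfl⟩ R hR
    refine ⟨((1 : Matrix ι ι ℂ) ⊗ₖ R)ᴴ * C * ((1 : Matrix ι ι ℂ) ⊗ₖ R),
      Matrix.PosSemidef.conjTranspose_mul_mul_same hC _, ?_⟩
    simp only [Φ, choiMap_congr, hR.eq]
  · rintro ⟨J, _, x, hx, hsum⟩
    choose C hC hCx using hx
    have h1 : Φ (∑ j, C j) = (1, X) := by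
      rw [← hsum]
      simp only [← hCx, Φ, choiMap_sum]
      ext1
      · simp [Prod.fst_sum]
      · ext i : 1
        simp [Prod.snd_sum]
    exact hXA (mem_matrixRange_of_choiMap hn
      (Matrix.posSemidef_sum _ fun j _ => hC j) (congrArg Prod.fst h1)
      fun i => congrFun (congrArg Prod.snd h1) i)
  · rintro Y ⟨hYh, hY, hYX⟩
    refine hYX (hX n Y ⟨hn, hYh, ?_⟩)
    have hL : (monicPencil A Y).IsHermitian := by
      rw [Matrix.IsHermitian, monicPencil, Matrix.conjTranspose_sub, Matrix.conjTranspose_one,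
        Matrix.conjTranspose_sum]
      simp only [Matrix.conjTranspose_kronecker, (hA _).eq, (hYh _).eq]
    refine Matrix.PosSemidef.of_dotProduct_mulVec_nonneg hL fun w => ?_
    have h1 := hY _ ⟨Matrix.vecMulVec (star w) w, Matrix.posSemidef_vecMulVec_star_self w, rfl⟩
    have h2 : star w ⬝ᵥ (monicPencil A Y *ᵥ w) =
        (choiMap (Matrix.vecMulVec (star w) w) 1).trace -
          ∑ i, ((Y i)ᵀ * choiMap (Matrix.vecMulVec (star w) w) (A i)).trace := by
      rw [monicPencil_mulVec, dotProduct_sub, dotProduct_sum, trace_choiMap_one,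
        Matrix.trace_vecMulVec]
      simp only [star_dotProduct_kronecker_mulVec]
    refine Complex.le_def.2 ⟨?_, (hL.im_star_dotProduct_mulVec_self w).symm⟩
    rw [h2, Complex.sub_re, Complex.re_sum, Complex.zero_re]
    exact sub_nonneg.2 h1

end PolarDual

/-! ### The minimal matrix convex set and its bipolar. -/

section MinimalSet

variable {g : ℕ} {κ : Type} [DecidableEq κ]

/-- The tuple of scalar matrices given by a point of `ℝᵍ`. -/
def scalarTuple (κ : Type) [DecidableEq κ] (y : EuclideanSpace ℝ (Fin g)) : MatTuple g κ :=
  fun i => (y i : ℂ) • 1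

/-- The compression `I - ∑ᵢ yᵢ Aᵢ` of the pencil of `A` at a point of `ℝᵍ`. -/
def scalarPencil (y : EuclideanSpace ℝ (Fin g)) (A : MatTuple g κ) : Matrix κ κ ℂ :=
  1 - ∑ i, (y i : ℂ) • A i

theorem isHermitian_scalarTuple {κ : Type} [DecidableEq κ]
    (y : EuclideanSpace ℝ (Fin g)) (i : Fin g) :
    (scalarTuple κ y i).IsHermitian := by
  simp [scalarTuple, Matrix.IsHermitian, Matrix.conjTranspose_smul]

theorem isHermitian_scalarPencil {κ : Type} [DecidableEq κ]
    (y : EuclideanSpace ℝ (Fin g)) {A : MatTuple g κ}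
    (hA : ∀ i, (A i).IsHermitian) : (scalarPencil y A).IsHermitian := by
  simp [scalarPencil, Matrix.IsHermitian, Matrix.conjTranspose_sub, Matrix.conjTranspose_sum,
    Matrix.conjTranspose_smul, (hA _).eq]

theorem monicPencil_eq_sum_kronecker {ι κ : Type} [DecidableEq ι] [DecidableEq κ]
    {J : Type} [Fintype J]
    {y : J → EuclideanSpace ℝ (Fin g)} {P : J → Matrix ι ι ℂ} (hP : ∑ j, P j = 1)
    {X : MatTuple g ι} (hX : ∀ i, X i = ∑ j, (y j i : ℂ) • P j) (Y : MatTuple g κ) :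
    monicPencil X Y = ∑ j, P j ⊗ₖ scalarPencil (y j) Y := by
  ext ⟨a, k⟩ ⟨b, l⟩
  rw [monicPencil, ← Matrix.one_kronecker_one, ← hP]
  simp only [scalarPencil, hX, Matrix.sub_apply, Matrix.sum_apply, Matrix.kroneckerMap_apply,
    Matrix.smul_apply, smul_eq_mul, mul_sub, Finset.sum_sub_distrib, Finset.sum_mul,
    Finset.mul_sum]
  rw [Finset.sum_comm]
  congr 1
  exact Finset.sum_congr rfl fun j _ => Finset.sum_congr rfl fun i _ => by ring

theorem monicPencil_scalarTuple_left {ι κ : Type} [DecidableEq ι] [DecidableEq κ]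
    (y : EuclideanSpace ℝ (Fin g)) (Y : MatTuple g κ) :
    monicPencil (scalarTuple ι y) Y = (1 : Matrix ι ι ℂ) ⊗ₖ scalarPencil y Y := by
  rw [monicPencil_eq_sum_kronecker (J := Unit) (y := fun _ => y) (P := fun _ => 1) (by simp)
    (fun i => by simp [scalarTuple])]
  simp

theorem monicPencil_scalarTuple_right {ι κ : Type} [DecidableEq ι] [DecidableEq κ]
    (y : EuclideanSpace ℝ (Fin g)) (A : MatTuple g ι) :
    monicPencil A (scalarTuple κ y) = scalarPencil y A ⊗ₖ (1 : Matrix κ κ ℂ) := by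
  ext ⟨a, k⟩ ⟨b, l⟩
  rw [monicPencil, ← Matrix.one_kronecker_one]
  simp only [scalarPencil, scalarTuple, Matrix.sub_apply, Matrix.sum_apply,
    Matrix.kroneckerMap_apply, Matrix.smul_apply, smul_eq_mul, sub_mul, Finset.sum_mul]
  congr 1
  exact Finset.sum_congr rfl fun i _ => by ring

theorem posSemidef_scalarPencil_of_left {ι κ : Type} [DecidableEq ι] [DecidableEq κ]
    [Nonempty ι] {y : EuclideanSpace ℝ (Fin g)}
    {Y : MatTuple g κ} (h : (monicPencil (scalarTuple ι y) Y).PosSemidef) :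
    (scalarPencil y Y).PosSemidef := by
  rw [monicPencil_scalarTuple_left] at h
  convert h.submatrix (fun k : κ => (Classical.arbitrary ι, k)) using 1
  ext k l
  simp

theorem scalarPencil_scalarTuple {κ : Type} [DecidableEq κ] (x y : EuclideanSpace ℝ (Fin g)) :
    scalarPencil y (scalarTuple κ x) = ((1 - inner ℝ x y : ℝ) : ℂ) • 1 := by
  simp [scalarPencil, scalarTuple, smul_smul, ← Finset.sum_smul, sub_smul, PiLp.inner_apply,
    -Complex.coe_smul]

theorem inner_le_one_of_posSemidef {κ : Type} [DecidableEq κ]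
    [Nonempty κ] {x y : EuclideanSpace ℝ (Fin g)}
    (h : (scalarPencil y (scalarTuple κ x)).PosSemidef) : inner ℝ x y ≤ 1 := by
  rw [scalarPencil_scalarTuple] at h
  have := h.diag_nonneg (i := Classical.arbitrary κ)
  rw [Matrix.smul_apply, Matrix.one_apply_eq, smul_eq_mul, mul_one] at this
  exact sub_nonneg.1 (by exact_mod_cast this)

theorem posSemidef_scalarPencil_scalarTuple {κ : Type} [DecidableEq κ]
    {x y : EuclideanSpace ℝ (Fin g)}
    (h : inner ℝ x y ≤ 1) : (scalarPencil y (scalarTuple κ x)).PosSemidef := by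
  rw [scalarPencil_scalarTuple]
  exact Matrix.PosSemidef.one.smul (by exact_mod_cast sub_nonneg.2 h)

theorem mem_scalarLevel_iff {C : Set (EuclideanSpace ℝ (Fin g))} {X : MatTuple g (Fin 1)} :
    X ∈ scalarLevel C ↔ ∃ v ∈ C, X = scalarTuple (Fin 1) v := by
  refine exists_congr fun v => and_congr_right fun _ => ?_
  rw [funext_iff]
  refine forall_congr' fun i => ?_
  have : (Matrix.of fun _ _ => ((v i : ℝ) : ℂ)) = scalarTuple (Fin 1) v i := by
    ext k l
    simp [scalarTuple, Subsingleton.elim k l]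
  rw [this]

theorem exists_eq_scalarTuple {X : MatTuple g (Fin 1)} (hX : ∀ i, (X i).IsHermitian) :
    ∃ x : EuclideanSpace ℝ (Fin g), X = scalarTuple (Fin 1) x := by
  refine ⟨WithLp.toLp 2 fun i => (X i 0 0).re, ?_⟩
  ext i k l
  rw [Subsingleton.elim k 0, Subsingleton.elim l 0]
  simpa [scalarTuple] using ((hX i).coe_re_apply_self 0).symm

theorem mem_closedBall_of_inner_le_one {x : EuclideanSpace ℝ (Fin g)}
    (h : ∀ y ∈ Metric.closedBall (0 : EuclideanSpace ℝ (Fin g)) 1, inner ℝ x y ≤ 1) :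
    x ∈ Metric.closedBall (0 : EuclideanSpace ℝ (Fin g)) 1 := by
  rw [mem_closedBall_zero_iff]
  rcases eq_or_ne x 0 with rfl | hx
  · simp
  have h1 := h (‖x‖⁻¹ • x) (by
    rw [mem_closedBall_zero_iff, norm_smul, norm_inv, norm_norm,
      inv_mul_cancel₀ (norm_ne_zero_iff.2 hx)])
  rwa [inner_smul_right, real_inner_self_eq_norm_mul_norm,
    inv_mul_cancel_left₀ (norm_ne_zero_iff.2 hx)] at h1

theorem inner_le_one_of_mem_closedBall {x y : EuclideanSpace ℝ (Fin g)}
    (hx : x ∈ Metric.closedBall (0 : EuclideanSpace ℝ (Fin g)) 1)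
    (hy : y ∈ Metric.closedBall (0 : EuclideanSpace ℝ (Fin g)) 1) : inner ℝ x y ≤ 1 := by
  rw [mem_closedBall_zero_iff] at hx hy
  exact (real_inner_le_norm x y).trans (mul_le_one₀ hx (norm_nonneg y) hy)

/-- The tuples with a joint dilation to commuting self-adjoint matrices with joint spectrum in
`C`, given through the positive operator valued measures which the dilations induce. -/
def minimalSet (C : Set (EuclideanSpace ℝ (Fin g))) : MatrixSet g :=
  fun n => {X | 0 < n ∧ ∃ (J : Type) (_ : Fintype J) (y : J → EuclideanSpace ℝ (Fin g))
    (P : J → Matrix (Fin n) (Fin n) ℂ), (∀ j, y j ∈ C) ∧ (∀ j, (P j).PosSemidef) ∧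
      ∑ j, P j = 1 ∧ ∀ i, X i = ∑ j, (y j i : ℂ) • P j}

theorem isMatrixConvex_minimalSet (C : Set (EuclideanSpace ℝ (Fin g))) :
    IsMatrixConvex (minimalSet C) where
  level_zero := by ext X; simp [minimalSet]
  combination_mem n hn m d Y V hY hV := by
    have hY' := fun j => (hY j).2
    choose J hJ y P hy hP hP1 hYP using hY'
    refine ⟨hn, Σ j, J j, inferInstance, fun q => y q.1 q.2,
      fun q => (V q.1)ᴴ * P q.1 q.2 * V q.1, fun q => hy _ _,
      fun q => (hP _ _).conjTranspose_mul_mul_same _, ?_, fun i => ?_⟩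
    · rw [Fintype.sum_sigma, ← hV]
      refine Finset.sum_congr rfl fun j _ => ?_
      simpa only [Matrix.mul_sum, Matrix.sum_mul, Matrix.mul_one] using
        congrArg (fun Q => (V j)ᴴ * Q * V j) (hP1 j)
    · rw [Fintype.sum_sigma]
      refine Finset.sum_congr rfl fun j _ => ?_
      simp only [hYP, Matrix.mul_sum, Matrix.sum_mul, Matrix.mul_smul, Matrix.smul_mul]

theorem scalarTuple_mem_minimalSet {C : Set (EuclideanSpace ℝ (Fin g))}
    {y : EuclideanSpace ℝ (Fin g)} (hy : y ∈ C) {n : ℕ} (hn : 0 < n) :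
    scalarTuple (Fin n) y ∈ minimalSet C n :=
  ⟨hn, Unit, inferInstance, fun _ => y, fun _ => 1, fun _ => hy, fun _ => Matrix.PosSemidef.one,
    by simp, fun i => by simp [scalarTuple]⟩

theorem minimalSet_mem_matrixConvexSetsOver {C : Set (EuclideanSpace ℝ (Fin g))}
    (hC : Convex ℝ C) : minimalSet C ∈ matrixConvexSetsOver C := by
  refine ⟨isMatrixConvex_minimalSet C, Set.ext fun X => ?_⟩
  rw [mem_scalarLevel_iff]
  constructor
  · rintro ⟨-, J, _, y, P, hy, hP, hP1, hX⟩
    have hre : ∀ j, (((P j 0 0).re : ℝ) : ℂ) = P j 0 0 := fun j => (hP j).1.coe_re_apply_self 0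
    refine ⟨∑ j, (P j 0 0).re • y j, hC.sum_mem (fun j _ => ?_) ?_ fun j _ => hy j, ?_⟩
    · exact (Complex.le_def.1 (hP j).diag_nonneg).1
    · have := congrFun (congrFun hP1 0) 0
      rw [Matrix.sum_apply, Matrix.one_apply_eq] at this
      rw [← Complex.re_sum, this, Complex.one_re]
    · ext i k l
      rw [Subsingleton.elim k 0, Subsingleton.elim l 0, hX]
      simp only [scalarTuple, Matrix.sum_apply, Matrix.smul_apply, smul_eq_mul,
        Matrix.one_apply_eq, mul_one, WithLp.ofLp_sum, WithLp.ofLp_smul, Finset.sum_apply,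
        Pi.smul_apply, Complex.ofReal_sum, Complex.ofReal_mul, hre]
      exact Finset.sum_congr rfl fun j _ => mul_comm _ _
  · rintro ⟨v, hv, rfl⟩
    exact scalarTuple_mem_minimalSet hv one_pos

/-- For `X = ∑ⱼ yⱼ ⊗ Pⱼ` the pencil is `∑ⱼ Pⱼ ⊗ (I - ∑ᵢ yⱼᵢ Yᵢ)`, so the scalar points impose all
the constraints. -/
theorem mem_freePolarDual_minimalSet_iff {C : Set (EuclideanSpace ℝ (Fin g))} {n : ℕ}
    {Y : MatTuple g (Fin n)} : Y ∈ freePolarDual (minimalSet C) n ↔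
      0 < n ∧ (∀ i, (Y i).IsHermitian) ∧ ∀ y ∈ C, (scalarPencil y Y).PosSemidef := by
  refine and_congr_right fun hn => and_congr_right fun hY => ⟨fun h y hy => ?_, fun h => ?_⟩
  · exact posSemidef_scalarPencil_of_left (h 1 _ (scalarTuple_mem_minimalSet hy one_pos))
  · rintro m X ⟨-, J, _, y, P, hy, hP, hP1, hX⟩
    rw [monicPencil_eq_sum_kronecker hP1 hX]
    exact Matrix.posSemidef_sum _ fun j _ => (hP j).kronecker (h _ (hy j))

theorem freePolarDual_minimalSet_closedBall_mem_matrixConvexSetsOver :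
    freePolarDual (minimalSet (Metric.closedBall (0 : EuclideanSpace ℝ (Fin g)) 1)) ∈
      matrixConvexSetsOver (Metric.closedBall (0 : EuclideanSpace ℝ (Fin g)) 1) := by
  refine ⟨isMatrixConvex_freePolarDual _, Set.ext fun X => ?_⟩
  rw [mem_scalarLevel_iff, mem_freePolarDual_minimalSet_iff]
  constructor
  · rintro ⟨-, hX, h⟩
    obtain ⟨x, rfl⟩ := exists_eq_scalarTuple hX
    exact ⟨x, mem_closedBall_of_inner_le_one fun y hy => inner_le_one_of_posSemidef (h y hy), rfl⟩
  · rintro ⟨x, hx, rfl⟩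
    exact ⟨one_pos, isHermitian_scalarTuple x, fun y hy =>
      posSemidef_scalarPencil_scalarTuple (inner_le_one_of_mem_closedBall hx hy)⟩

theorem star_dotProduct_mulVec_eq_trace {κ : Type} [Fintype κ] (M : Matrix κ κ ℂ) (v : κ → ℂ) :
    star v ⬝ᵥ (M *ᵥ v) = (Mᵀ * Matrix.vecMulVec (star v) v).trace := by
  simp only [dotProduct, Matrix.mulVec, Matrix.trace, Matrix.diag_apply, Matrix.mul_apply,
    Matrix.vecMulVec_apply, Matrix.transpose_apply, Finset.mul_sum]
  rw [Finset.sum_comm]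
  exact Finset.sum_congr rfl fun k _ => Finset.sum_congr rfl fun l _ => by ring

/-- The bipolar theorem for the minimal matrix convex set over a compact set containing `0`. -/
theorem mem_minimalSet_of_posSemidef {C : Set (EuclideanSpace ℝ (Fin g))} (hC : IsCompact C)
    (h0 : 0 ∈ C) {n : ℕ} (hn : 0 < n) {X : MatTuple g (Fin n)} (hXh : ∀ i, (X i).IsHermitian)
    (hX : ∀ Y ∈ freePolarDual (minimalSet C) n, (monicPencil Y X).PosSemidef) :
    X ∈ minimalSet C n := by
  by_contra hXC
  have : Nonempty (Fin n) := ⟨⟨0, hn⟩⟩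
  let Φ : EuclideanSpace ℝ (Fin g) × Matrix (Fin n) (Fin n) ℂ →
      Matrix (Fin n) (Fin n) ℂ × MatTuple g (Fin n) :=
    fun q => (q.2, fun i => (q.1 i : ℂ) • q.2)
  have hΦ : Continuous Φ := by
    refine continuous_snd.prodMk (continuous_pi fun i => ?_)
    exact (Complex.continuous_ofReal.comp
      ((EuclideanSpace.proj (𝕜 := ℝ) i).continuous.comp continuous_fst)).smul continuous_snd
  -- This cone is not convex in general; its finite sums with first component `1` are exactly the
  -- elements of the minimal set. The point `0 ∈ C` supplies the pairs `(P, 0)`.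
  let G : Set (Matrix (Fin n) (Fin n) ℂ × MatTuple g (Fin n)) :=
    Φ '' (C ×ˢ {P | P.PosSemidef})
  refine Exists.elim (exists_separating_pencil G (X := X) ?_ ?_ ?_ ?_ ?_ ?_ hXh ?_) ?_
  · convert (hC.prod (isCompact_posSemidef_trace_one (κ := Fin n))).image hΦ using 1
    ext x
    constructor
    · rintro ⟨⟨⟨y, P⟩, ⟨hy, hP⟩, rfl⟩, h⟩
      exact ⟨(y, P), ⟨hy, hP, h⟩, rfl⟩
    · rintro ⟨⟨y, P⟩, ⟨hy, hP, h⟩, rfl⟩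
      exact ⟨⟨(y, P), ⟨hy, hP⟩, rfl⟩, h⟩
  · rintro _ ⟨⟨y, P⟩, ⟨hy, hP⟩, rfl⟩ t ht
    refine ⟨(y, t • P), ⟨hy, Matrix.PosSemidef.smul hP ht⟩, ?_⟩
    simp only [Φ, Prod.smul_mk, Prod.mk.injEq, true_and]
    ext1 i
    exact smul_comm _ _ _
  · rintro _ ⟨⟨y, P⟩, ⟨hy, hP⟩, rfl⟩
    refine ⟨hP, fun i => ?_⟩
    simp only [Φ, Matrix.IsHermitian, Matrix.conjTranspose_smul, Complex.star_def,
      Complex.conj_ofReal, Matrix.PosSemidef.isHermitian hP |>.eq]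
  · rintro _ ⟨⟨y, P⟩, ⟨hy, hP⟩, rfl⟩ h
    obtain rfl : P = 0 := h
    simp only [Φ, smul_zero]
    rfl
  · intro P hP
    refine ⟨(0, P), ⟨h0, hP⟩, ?_⟩
    simp only [Φ, PiLp.zero_apply, Complex.ofReal_zero, zero_smul]
    rfl
  · rintro _ ⟨⟨y, P⟩, ⟨hy, hP⟩, rfl⟩ R hR
    refine ⟨(y, R * P * R), ⟨hy, ?_⟩, ?_⟩
    · have := Matrix.PosSemidef.conjTranspose_mul_mul_same hP R
      rwa [hR.eq] at this
    · simp only [Φ, Matrix.mul_smul, Matrix.smul_mul]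
  · rintro ⟨J, _, x, hx, hsum⟩
    choose q hq hqx using hx
    refine hXC ⟨hn, J, inferInstance, fun j => (q j).1, fun j => (q j).2, fun j => (hq j).1,
      fun j => (hq j).2, ?_, fun i => ?_⟩
    · have := congrArg Prod.fst hsum
      simpa [← hqx, Φ, Prod.fst_sum] using this
    · have := congrFun (congrArg Prod.snd hsum) i
      simpa [← hqx, Φ, Prod.snd_sum] using this.symm
  · rintro Y ⟨hYh, hY, hYX⟩
    refine hYX (hX Y (mem_freePolarDual_minimalSet_iff.2 ⟨hn, hYh, fun y hy => ?_⟩))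
    have hL := isHermitian_scalarPencil y hYh
    refine Matrix.PosSemidef.of_dotProduct_mulVec_nonneg hL fun w => ?_
    have h1 := hY _ ⟨(y, Matrix.vecMulVec (star w) w),
      ⟨hy, Matrix.posSemidef_vecMulVec_star_self w⟩, rfl⟩
    refine Complex.le_def.2 ⟨?_, (hL.im_star_dotProduct_mulVec_self w).symm⟩
    have h2 : star w ⬝ᵥ (scalarPencil y Y *ᵥ w) = (Matrix.vecMulVec (star w) w).trace -
        ∑ i, ((Y i)ᵀ * ((y i : ℂ) • Matrix.vecMulVec (star w) w)).trace := by
      rw [star_dotProduct_mulVec_eq_trace, scalarPencil, Matrix.transpose_sub,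
        Matrix.transpose_one, Matrix.transpose_sum, Matrix.sub_mul, Matrix.one_mul,
        Matrix.trace_sub, Matrix.sum_mul, Matrix.trace_sum]
      simp only [Matrix.transpose_smul, Matrix.smul_mul, Matrix.mul_smul]
    rw [h2, Complex.sub_re, Complex.re_sum, Complex.zero_re]
    exact sub_nonneg.2 h1

end MinimalSet

/-! ### The spin triple over the Euclidean ball. -/

section SpinBall

variable {g : ℕ}

theorem eq_scalarTuple_of_unitarilyEquivalent {κ ι : Type} [Fintype κ] [DecidableEq κ]
    [Fintype ι] [DecidableEq ι] {y : EuclideanSpace ℝ (Fin g)} {X : MatTuple g ι}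
    (h : UnitarilyEquivalent (scalarTuple κ y) X) : X = scalarTuple ι y := by
  obtain ⟨U, hU, -, hX⟩ := h
  ext1 i
  rw [← hX, scalarTuple, Matrix.mul_smul, Matrix.smul_mul, Matrix.mul_one, hU]
  rfl

/-- A free extreme point which lies in the minimal matrix convex set over `C` is scalar. -/
theorem exists_eq_scalarTuple_of_mem_freeExtremePoints {K : MatrixSet g}
    {C : Set (EuclideanSpace ℝ (Fin g))} {n : ℕ} {X : MatTuple g (Fin n)}
    (hK : ∀ y ∈ C, scalarTuple (Fin n) y ∈ K n) (hX : X ∈ freeExtremePoints K n)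
    (hXC : X ∈ minimalSet C n) : ∃ y, X = scalarTuple (Fin n) y := by
  classical
  obtain ⟨hn, J, _, y, P, hy, hP, hP1, hXP⟩ := hXC
  have : Nonempty (Fin n) := ⟨⟨0, hn⟩⟩
  -- Free extremality only speaks of nonzero coefficients, so the terms with `P j = 0` are dropped.
  let e := Fintype.equivFin {j // P j ≠ 0}
  have hsum : ∀ {M : Type} [AddCommMonoid M] (f : J → M), (∀ j, P j = 0 → f j = 0) →
      ∑ k, f (e.symm k) = ∑ j, f j := by
    intro M _ f hf
    rw [e.symm.sum_comp fun j : {j // P j ≠ 0} => f j]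
    rw [← Fintype.sum_subtype_add_sum_subtype (fun j => P j ≠ 0) f,
      Finset.sum_eq_zero fun (j : {j // ¬ P j ≠ 0}) _ => hf j (not_not.1 j.2), add_zero]
  choose S hS using fun j => CStarAlgebra.nonneg_iff_eq_star_mul_self.1 (hP j).nonneg
  simp only [Matrix.star_eq_conjTranspose] at hS
  have hne : ∃ j, P j ≠ 0 := by
    by_contra! h
    simp [h] at hP1
  obtain ⟨j₀, hj₀⟩ := hne
  have h1 := hX.2 _ (fun _ => n) (fun k => scalarTuple (Fin n) (y (e.symm k)))
    (fun k => S (e.symm k)) (fun k => hK _ (hy _))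
    (fun k h => (e.symm k).2 (by rw [hS, h, Matrix.mul_zero]))
    (by
      simp only [← hS]
      rw [hsum P fun _ h => h, hP1])
    (fun i => by
      simp only [scalarTuple, Matrix.mul_smul, Matrix.smul_mul, Matrix.mul_one, ← hS]
      rw [hsum (fun j => (y j i : ℂ) • P j) fun j h => by simp [h], hXP]) (e ⟨j₀, hj₀⟩)
  refine ⟨y (e.symm (e ⟨j₀, hj₀⟩)), ?_⟩
  rcases h1 with h1 | ⟨k, -, Z, h1⟩
  · exact eq_scalarTuple_of_unitarilyEquivalent h1
  · have h2 := eq_scalarTuple_of_unitarilyEquivalent h1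
    ext i p q
    have := congrFun (congrFun (congrFun h2 i) (Sum.inl p)) (Sum.inl q)
    simpa [tupleSum, scalarTuple, Matrix.one_apply] using this

theorem isHermitian_spinTriple (i : Fin 3) : (spinTriple i).IsHermitian := by
  rw [spinTriple_eq_complexMatrix, Matrix.IsHermitian, ← complexMatrix_conjTranspose]
  congr 1
  revert i
  decide +kernel

theorem trace_spinTriple (i : Fin 3) : (spinTriple i).trace = 0 := by
  have h : ∀ i, (integerSpinTriple i).trace = 0 := by decide +kernel
  have := congrArg GaussianInt.toComplex (h i)
  rw [spinTriple_eq_complexMatrix]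
  simpa [complexMatrix, Matrix.trace] using this

theorem spinTriple_apply (i : Fin 3) (p q : Fin 2 × Fin 2) :
    spinTriple i p q = GaussianInt.toComplex (integerSpinTriple i p q) := by
  rw [spinTriple_eq_complexMatrix]
  rfl

theorem sum_smul_spinTriple_mul_self (x : EuclideanSpace ℝ (Fin 3)) :
    (∑ i, (x i : ℂ) • spinTriple i) * ∑ i, (x i : ℂ) • spinTriple i =
      ((‖x‖ ^ 2 : ℝ) : ℂ) • 1 := by
  rw [EuclideanSpace.real_norm_sq_eq]
  ext ⟨a, b⟩ ⟨c, d⟩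
  fin_cases a <;> fin_cases b <;> fin_cases c <;> fin_cases d <;>
    simp [spinTriple, spinStep, spinPair, Fin.snoc, Fin.sum_univ_three, Matrix.mul_apply,
      Fintype.sum_prod_type, Matrix.add_apply] <;>
    ring

theorem sum_spinTriple_mul_spinTriple (i j : Fin 3) :
    ∑ p, ∑ q, spinTriple i p q * spinTriple j p q = if i = j then 4 else 0 := by
  have h : ∀ i j, ∑ p, ∑ q, integerSpinTriple i p q * integerSpinTriple j p q =
      if i = j then 4 else 0 := by decide +kernel
  have := congrArg GaussianInt.toComplex (h i j)
  simp only [map_sum, map_mul, apply_ite GaussianInt.toComplex, map_zero, map_ofNat] at this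
  simpa only [spinTriple_apply] using this

/-- Anticommutation gives `N² = ‖x‖²` for `N = ∑ᵢ xᵢ Fᵢ`, hence `1 - N = ((1 - N)² + (1 - ‖x‖²)) /
2`. -/
theorem posSemidef_scalarPencil_spinTriple {x : EuclideanSpace ℝ (Fin 3)}
    (hx : x ∈ Metric.closedBall (0 : EuclideanSpace ℝ (Fin 3)) 1) :
    (scalarPencil x spinTriple).PosSemidef := by
  rw [mem_closedBall_zero_iff] at hx
  have hL := isHermitian_scalarPencil x isHermitian_spinTriple
  have h1 : scalarPencil x spinTriple = (2⁻¹ : ℝ) •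
      ((scalarPencil x spinTriple)ᴴ * scalarPencil x spinTriple + (1 - ‖x‖ ^ 2 : ℝ) • 1) := by
    rw [hL.eq, scalarPencil]
    set N := ∑ i, (x i : ℂ) • spinTriple i with hN
    have h2 : (1 - N) * (1 - N) = 1 - (2 : ℝ) • N + (‖x‖ ^ 2 : ℝ) • 1 := by
      rw [Matrix.sub_mul, Matrix.mul_sub, Matrix.mul_sub, hN, sum_smul_spinTriple_mul_self,
        two_smul, Matrix.one_mul, Matrix.one_mul, Matrix.mul_one, Complex.coe_smul]
      abel
    rw [h2]
    module
  rw [h1]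
  exact ((Matrix.posSemidef_conjTranspose_mul_self _).add
    (Matrix.PosSemidef.one.smul (by nlinarith [norm_nonneg x]))).smul (by norm_num)

theorem scalarTuple_mem_freeSpectrahedron_spinTriple {x : EuclideanSpace ℝ (Fin 3)}
    (hx : x ∈ Metric.closedBall (0 : EuclideanSpace ℝ (Fin 3)) 1) {n : ℕ} (hn : 0 < n) :
    scalarTuple (Fin n) x ∈ freeSpectrahedron spinTriple n := by
  refine ⟨hn, isHermitian_scalarTuple x, ?_⟩
  rw [monicPencil_scalarTuple_right]
  exact (posSemidef_scalarPencil_spinTriple hx).kronecker Matrix.PosSemidef.one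

/-- The state with density matrix `(I + ∑ᵢ yᵢ Fᵢ) / 4` sends `Fᵢ` to `yᵢ`, because the `Fᵢ` are
traceless and trace-orthogonal. The plus sign is why the pencil is taken at `-y`. -/
theorem scalarTuple_mem_matrixRange_spinTriple {y : EuclideanSpace ℝ (Fin 3)}
    (hy : y ∈ Metric.closedBall (0 : EuclideanSpace ℝ (Fin 3)) 1) :
    scalarTuple (Fin 1) y ∈ matrixRange spinTriple 1 := by
  have hy' : -y ∈ Metric.closedBall (0 : EuclideanSpace ℝ (Fin 3)) 1 := by
    rwa [mem_closedBall_zero_iff, norm_neg, ← mem_closedBall_zero_iff]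
  let C : Matrix ((Fin 2 × Fin 2) × Fin 1) ((Fin 2 × Fin 2) × Fin 1) ℂ :=
    (4⁻¹ : ℝ) • (scalarPencil (-y) spinTriple ⊗ₖ 1)
  have hC : C.PosSemidef := ((posSemidef_scalarPencil_spinTriple hy').kronecker
    Matrix.PosSemidef.one).smul (by norm_num)
  have hCM : ∀ M, choiMap C M =
      ((4⁻¹ : ℂ) * (M.trace + ∑ i, (y i : ℂ) * ∑ a, ∑ b, M a b * spinTriple i a b)) •
        (1 : Matrix (Fin 1) (Fin 1) ℂ) := by
    intro M
    ext k l
    rw [Subsingleton.elim k 0, Subsingleton.elim l 0, choiMap_apply]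
    have h : ∀ a b, M a b * C (a, 0) (b, 0) = 4⁻¹ * (M a b * (1 : Matrix _ _ ℂ) a b +
        ∑ i, (y i : ℂ) * (M a b * spinTriple i a b)) := by
      intro a b
      have : ∑ i, (y i : ℂ) * (M a b * spinTriple i a b) =
          M a b * ∑ i, (y i : ℂ) * spinTriple i a b := by
        rw [Finset.mul_sum]
        exact Finset.sum_congr rfl fun i _ => by ring
      rw [this]
      simp [C, scalarPencil, Matrix.sum_apply]
      ring
    simp only [h, ← Finset.mul_sum, Finset.sum_add_distrib]
    rw [Matrix.smul_apply, Matrix.one_apply_eq, smul_eq_mul, mul_one]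
    congr 2
    · simp [Matrix.one_apply, Matrix.trace]
    · simp only [Finset.mul_sum]
      symm
      rw [Finset.sum_comm]
      refine Finset.sum_congr rfl fun a _ => ?_
      rw [Finset.sum_comm]
  refine mem_matrixRange_of_choiMap one_pos hC ?_ fun i => ?_
  · have h : ∀ i, ∑ a, ∑ b, (1 : Matrix (Fin 2 × Fin 2) (Fin 2 × Fin 2) ℂ) a b *
        spinTriple i a b = 0 := by
      intro i
      simpa [Matrix.one_apply, Matrix.trace] using trace_spinTriple i
    rw [hCM]
    simp [h]
  · rw [hCM, trace_spinTriple]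
    simp only [sum_spinTriple_mul_spinTriple, scalarTuple, zero_add, mul_ite, mul_zero,
      Finset.sum_ite_eq, Finset.mem_univ, if_true]
    congr 1
    ring

theorem freePolarDual_freeSpectrahedron_spinTriple :
    freePolarDual (freeSpectrahedron spinTriple) = matrixRange spinTriple :=
  le_antisymm (freePolarDual_freeSpectrahedron_le isHermitian_spinTriple trace_spinTriple)
    (matrixRange_le_freePolarDual isHermitian_spinTriple)

theorem inner_le_one_of_mem_freePolarDual {K : MatrixSet g}
    {x y : EuclideanSpace ℝ (Fin g)} (hx : scalarTuple (Fin 1) x ∈ K 1)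
    (hy : scalarTuple (Fin 1) y ∈ freePolarDual K 1) : inner ℝ y x ≤ 1 :=
  inner_le_one_of_posSemidef (posSemidef_scalarPencil_of_left (hy.2.2 1 _ hx))

theorem freeSpectrahedron_spinTriple_mem_matrixConvexSetsOver :
    freeSpectrahedron spinTriple ∈
      matrixConvexSetsOver (Metric.closedBall (0 : EuclideanSpace ℝ (Fin 3)) 1) := by
  refine ⟨isMatrixConvex_freeSpectrahedron _, Set.ext fun X => ?_⟩
  rw [mem_scalarLevel_iff]
  constructor
  · intro hX
    obtain ⟨x, rfl⟩ := exists_eq_scalarTuple hX.2.1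
    -- Every `y` in the ball lies in the matrix range, which is the polar dual, so `⟨x, y⟩ ≤ 1` for
    -- all of them and `x` lies in the ball.
    refine ⟨x, mem_closedBall_of_inner_le_one fun y hy => ?_, rfl⟩
    rw [real_inner_comm]
    refine inner_le_one_of_mem_freePolarDual hX ?_
    rw [freePolarDual_freeSpectrahedron_spinTriple]
    exact scalarTuple_mem_matrixRange_spinTriple hy
  · rintro ⟨x, hx, rfl⟩
    exact scalarTuple_mem_freeSpectrahedron_spinTriple hx one_pos

theorem matrixRange_spinTriple_mem_matrixConvexSetsOver :
    matrixRange spinTriple ∈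
      matrixConvexSetsOver (Metric.closedBall (0 : EuclideanSpace ℝ (Fin 3)) 1) := by
  rw [← freePolarDual_freeSpectrahedron_spinTriple]
  refine ⟨isMatrixConvex_freePolarDual _, Set.ext fun X => ?_⟩
  rw [mem_scalarLevel_iff]
  constructor
  · intro hX
    obtain ⟨x, rfl⟩ := exists_eq_scalarTuple hX.2.1
    exact ⟨x, mem_closedBall_of_inner_le_one fun y hy =>
      inner_le_one_of_mem_freePolarDual
        (scalarTuple_mem_freeSpectrahedron_spinTriple hy one_pos) hX, rfl⟩
  · rintro ⟨x, hx, rfl⟩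
    rw [freePolarDual_freeSpectrahedron_spinTriple]
    exact scalarTuple_mem_matrixRange_spinTriple hx

theorem four_notMem_minimalSet : scaledTuple 5 (phaseTuple coeffFour) ∉
    minimalSet (Metric.closedBall (0 : EuclideanSpace ℝ (Fin 3)) 1) 4 := by
  intro h
  obtain ⟨y, hy⟩ := exists_eq_scalarTuple_of_mem_freeExtremePoints
    (fun y hy => scalarTuple_mem_freeSpectrahedron_spinTriple hy (by norm_num))
    (mem_freeExtremePoints_freeSpectrahedron mem_freeSpectrahedron_four
      kernelNondegenerate_four trivialCommutant_four) h
  -- The entry is `3/5`, but a scalar matrix vanishes off the diagonal.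
  have h1 := congrFun (congrFun (congrFun hy 0) 0) 3
  simp [scaledTuple, complexMatrix, phaseTuple, coeffFour, scalarTuple,
    GaussianInt.toComplex_def] at h1

end SpinBall

end

theorem theorem2 :
    -- free extreme points at levels 4 and 6
    (freeExtremePoints (freeSpectrahedron spinTriple) 4).Nonempty ∧
    (freeExtremePoints (freeSpectrahedron spinTriple) 6).Nonempty ∧
    -- more precisely, of the form `[[0, Cᵢ], [C̄ᵢ, 0]]`, at level `n = k + k`, with `Cᵢ` symmetric
    (∀ k : ℕ, k = 2 ∨ k = 3 → ∃ C : MatTuple 3 (Fin k), (∀ i, (C i).IsSymm) ∧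
      offDiagonalTuple C ∈ freeExtremePoints (freeSpectrahedron spinTriple) (k + k)) ∧
    -- the free spectrahedron is over the closed ball but is not minimal
    freeSpectrahedron spinTriple ∈
      matrixConvexSetsOver (Metric.closedBall (0 : EuclideanSpace ℝ (Fin 3)) 1) ∧
    ¬ IsMinimalOver (Metric.closedBall (0 : EuclideanSpace ℝ (Fin 3)) 1)
      (freeSpectrahedron spinTriple) ∧
    -- its free polar dual is the matrix range, which is over the closed ball but is not maximal
    freePolarDual (freeSpectrahedron spinTriple) = matrixRange spinTriple ∧
    matrixRange spinTriple ∈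
      matrixConvexSetsOver (Metric.closedBall (0 : EuclideanSpace ℝ (Fin 3)) 1) ∧
    ¬ IsMaximalOver (Metric.closedBall (0 : EuclideanSpace ℝ (Fin 3)) 1)
      (matrixRange spinTriple) := by
  have h4 := exists_offDiagonalTuple_mem_freeExtremePoints 2 (Or.inl rfl)
  have h6 := exists_offDiagonalTuple_mem_freeExtremePoints 3 (Or.inr rfl)
  refine ⟨h4.imp' offDiagonalTuple fun _ h => h.2, h6.imp' offDiagonalTuple fun _ h => h.2,
    exists_offDiagonalTuple_mem_freeExtremePoints,
    freeSpectrahedron_spinTriple_mem_matrixConvexSetsOver, fun hmin => ?_,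
    freePolarDual_freeSpectrahedron_spinTriple, matrixRange_spinTriple_mem_matrixConvexSetsOver,
    fun hmax => ?_⟩
  · exact four_notMem_minimalSet
      (hmin.2 (minimalSet_mem_matrixConvexSetsOver (convex_closedBall _ _)) 4
        mem_freeSpectrahedron_four)
  -- Maximality would put every `Y` in the polar dual of the minimal set into `D_{F^[3]}°`. Then
  -- `L_Y(X) ≥ 0` for the level 4 point `X`, and the bipolar theorem gives the contradiction.
  · refine four_notMem_minimalSet (mem_minimalSet_of_posSemidef (isCompact_closedBall _ _)
      (Metric.mem_closedBall_self zero_le_one) (by norm_num) mem_freeSpectrahedron_four.2.1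
      fun Y hY => ?_)
    have h := hmax.2 freePolarDual_minimalSet_closedBall_mem_matrixConvexSetsOver 4 hY
    rw [← freePolarDual_freeSpectrahedron_spinTriple] at h
    exact posSemidef_monicPencil_comm.1 (h.2.2 4 _ mem_freeSpectrahedron_four)
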